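/- Let $n\in\mathbb N$, let $\mathbb T^n=[0,1)^n$ with Lebesgue measure, and for $k,l\in\mathbb Z^n$ let $T^t_{(k,l)}f(x,y)=e^{\pi i(x\cdot l-y\cdot k)}f(x-k,y-l)$ on $L^2(\mathbb R^{2n})$. For $f\in L^2(\mathbb R^{2n})$ let $K_f(\xi,\eta)=\int_{\mathbb R^n}f(x,\eta-\xi)e^{\pi i x\cdot(\xi+\eta)}\,dx$ be the kernel of its Weyl transform (the integral being extended from $L^1\cap L^2$ to $L^2$ by Plancherel's theorem), and define $\mathcal J:L^2(\mathbb R^{2n})\to L^2(\mathbb T^n\times\mathbb T^n,L^2(\mathbb R^n))$ by $$\mathcal Jf(\xi,\xi')(\eta)=\sum_{m\in\mathbb Z^n}K_f(m+\xi,\eta)e^{-2\pi i m\cdot\xi'},$$ the series converging in $L^2(\mathbb T^n\times\mathbb T^n\times\mathbb R^n)$. Let $V\subset L^2(\mathbb R^{2n})$ be a twisted shift-invariant space, i.e. a closed subspace with $T^t_{(k,l)}V\subset V$ for all $k,l\in\mathbb Z^n$, and let $J$ be its range function: $J(\xi,\xi')$ is the closed linear span in $L^2(\mathbb R^n)$ of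 the vectors $\mathcal Jf(\xi,\xi')$, where $f$ runs through a countable dense subset of $V$ (up to a.e. equality, $J$ does not depend on that subset). Let $P(\xi,\xi')$ be the orthogonal projection of $L^2(\mathbb R^n)$ onto $J(\xi,\xi')$. A twisted shift preserving operator $U:V\to L^2(\mathbb R^{2n})$ is a bounded linear operator with $UT^t_{(k,l)}f=T^t_{(k,l)}Uf$ for all $f\in V$ and $k,l\in\mathbb Z^n$. A range operator $R$ on $J$ is a family of bounded linear operators $R(\xi,\xi'):J(\xi,\xi')\to L^2(\mathbb R^n)$; it is measurable if $(\xi,\xi')\mapsto\langle R(\xi,\xi')P(\xi,\xi')a,b\rangle$ is Lebesgue measurable for all $a,b\in L^2(\mathbb R^n)$. Range operators are identified if they are equal a.e. Consider the relation $$(\mathcal J\circ U)f(\xi,\xi')=R(\xi,\xi')\bigl(\mathcal Jf(\xi,\xi')\bigr)\quad\text{for a.e. }(\xi,\xi')\in\mathbb T^n\times\mathbb T^n,\ \text{for every } f\in V.\tag{$*$}$$ (1) For every twisted shift preserving operator $U:V\to L^2(\mathbb R^{2n})$ there is a measurable range operator $R$ on $J$ such that $(*)$ holds; it satisfies $\operatorname{ess\,sup}\|R(\xi,\xi')\|<\infty$,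 and it is the only measurable range operator on $J$, up to a.e. equality, for which $(*)$ holds. (2) Conversely, for every measurable range operator $R$ on $J$ with $\operatorname{ess\,sup}_{(\xi,\xi')}\|R(\xi,\xi')\|<\infty$ there is exactly one twisted shift preserving operator $U:V\to L^2(\mathbb R^{2n})$ such that $(*)$ holds. Hence $(*)$ is a one-to-one correspondence between the twisted shift preserving operators $U:V\to L^2(\mathbb R^{2n})$ and the essentially bounded measurable range operators $R$ on $J$ (up to a.e. equality). -/

import Mathlib

open MeasureTheory Filter Topology
open scoped ENNReal RealInnerProductSpace FourierTransform

noncomputable section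

set_option linter.unusedSectionVars false

namespace TwistedShift

section Curry

variable {α β : Type*} [MeasurableSpace α] [MeasurableSpace β] {μ : Measure α} {ν : Measure β}

/-- The slice `f(x, ·)` as an element of `L²(ν)` (and `0` if it is not square integrable). -/
def slice (ν : Measure β) (f : α × β → ℂ) (x : α) : Lp ℂ 2 ν := by
  classical
  exact if h : MemLp (fun y => f (x, y)) 2 ν then h.toLp _ else 0

theorem slice_of_memLp {f : α × β → ℂ} {x : α} (h : MemLp (fun y => f (x, y)) 2 ν) :
    slice ν f x = h.toLp _ := by
  simp [slice, h]

theorem eLpNorm_two_sq {γ : Type*} [MeasurableSpace γ] {E : Type*} [NormedAddCommGroup E]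
    (ρ : Measure γ) (g : γ → E) : eLpNorm g 2 ρ ^ 2 = ∫⁻ x, ‖g x‖ₑ ^ 2 ∂ρ := by
  have h := eLpNorm_nnreal_pow_eq_lintegral (f := g) (μ := ρ) (p := 2) (by norm_num)
  simpa using h

theorem memLp_two_iff {γ : Type*} [MeasurableSpace γ] {E : Type*} [NormedAddCommGroup E]
    {ρ : Measure γ} {g : γ → E} (hg : AEStronglyMeasurable g ρ) :
    MemLp g 2 ρ ↔ ∫⁻ x, ‖g x‖ₑ ^ 2 ∂ρ < ∞ := by
  rw [← eLpNorm_two_sq]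
  constructor
  · intro h
    exact ENNReal.pow_lt_top h.2
  · intro h
    refine ⟨hg, ?_⟩
    by_contra hc
    have : eLpNorm g 2 ρ = ∞ := by simpa using hc
    simp [this] at h

variable [SFinite ν]

theorem ae_memLp_slice [SFinite μ] {f : α × β → ℂ} (hf : MemLp f 2 (μ.prod ν)) :
    ∀ᵐ x ∂μ, MemLp (fun y => f (x, y)) 2 ν := by
  have h1 := hf.1.prodMk_left
  have h2 : ∫⁻ x, ∫⁻ y, ‖f (x, y)‖ₑ ^ 2 ∂ν ∂μ ≠ ∞ := by
    rw [← lintegral_prod _ (hf.1.enorm.pow_const 2)]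
    exact ((memLp_two_iff hf.1).1 hf).ne
  have h3 := ae_lt_top' (hf.1.enorm.pow_const 2).lintegral_prod_right' h2
  filter_upwards [h1, h3] with x hx1 hx2
  exact (memLp_two_iff hx1).2 hx2

theorem enorm_slice_sub {f : α × β → ℂ} {x : α} (h : MemLp (fun y => f (x, y)) 2 ν)
    (c : Lp ℂ 2 ν) : ‖slice ν f x - c‖ₑ ^ 2 = ∫⁻ y, ‖f (x, y) - c y‖ₑ ^ 2 ∂ν := by
  rw [slice_of_memLp h, Lp.enorm_def, eLpNorm_two_sq]
  refine lintegral_congr_ae ?_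
  filter_upwards [Lp.coeFn_sub (h.toLp _) c, h.coeFn_toLp] with y h1 h2
  rw [h1, Pi.sub_apply, h2]

theorem enorm_slice {f : α × β → ℂ} {x : α} (h : MemLp (fun y => f (x, y)) 2 ν) :
    ‖slice ν f x‖ₑ ^ 2 = ∫⁻ y, ‖f (x, y)‖ₑ ^ 2 ∂ν := by
  rw [slice_of_memLp h, Lp.enorm_def, eLpNorm_two_sq]
  refine lintegral_congr_ae ?_
  filter_upwards [h.coeFn_toLp] with y h2
  rw [h2]

theorem slice_congr [SFinite μ] {f g : α × β → ℂ} (hfg : f =ᵐ[μ.prod ν] g) :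
    slice ν f =ᵐ[μ] slice ν g := by
  filter_upwards [Measure.ae_ae_of_ae_prod hfg] with x hx
  by_cases h : MemLp (fun y => f (x, y)) 2 ν
  · have h' : MemLp (fun y => g (x, y)) 2 ν := (memLp_congr_ae hx).1 h
    rw [slice_of_memLp h, slice_of_memLp h']
    exact (MemLp.toLp_eq_toLp_iff _ _).2 hx
  · have h' : ¬ MemLp (fun y => g (x, y)) 2 ν := fun h' => h ((memLp_congr_ae hx).2 h')
    simp [slice, h, h']

variable [SecondCountableTopology (Lp ℂ 2 ν)]

theorem aestronglyMeasurable_slice [SFinite μ] {f : α × β → ℂ} (hf : MemLp f 2 (μ.prod ν)) :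
    AEStronglyMeasurable (slice ν f) μ := by
  let : MeasurableSpace (Lp ℂ 2 ν) := borel _
  have : BorelSpace (Lp ℂ 2 ν) := ⟨rfl⟩
  obtain ⟨s, hs, hsub⟩ : ∃ s, MeasurableSet s ∧ (∀ᵐ x ∂μ, x ∈ s) ∧
      ∀ x ∈ s, MemLp (fun y => (hf.1.mk f) (x, y)) 2 ν := by
    have h := ae_memLp_slice ((memLp_congr_ae hf.1.ae_eq_mk).1 hf)
    obtain ⟨t, ht1, ht2, ht3⟩ := exists_measurable_superset_of_null (ae_iff.1 h)
    refine ⟨tᶜ, ht2.compl, ?_, ?_⟩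
    · rw [ae_iff]; simpa using ht3
    · intro x hx
      by_contra hc
      exact hx (ht1 hc)
  have hmeas : StronglyMeasurable (hf.1.mk f) := hf.1.stronglyMeasurable_mk
  have key : Measurable (s.indicator (slice ν (hf.1.mk f))) := by
    refine measurable_of_isOpen fun U hU => ?_
    obtain ⟨S, hS, hSU⟩ := (TopologicalSpace.isOpen_iUnion_countable
      (fun p : {p : Lp ℂ 2 ν × ℝ // Metric.ball p.1 p.2 ⊆ U} => Metric.ball p.1.1 p.1.2)
      (fun _ => Metric.isOpen_ball))
    have hU' : U = ⋃ p ∈ S, Metric.ball p.1.1 p.1.2 := by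
      rw [hSU]
      ext z
      simp only [Set.mem_iUnion]
      constructor
      · intro hz
        obtain ⟨ε, hε, hb⟩ := Metric.isOpen_iff.1 hU z hz
        exact ⟨⟨(z, ε), hb⟩, Metric.mem_ball_self hε⟩
      · rintro ⟨p, hp⟩
        exact p.2 hp
    rw [hU', Set.preimage_iUnion₂]
    refine MeasurableSet.biUnion hS fun p _ => ?_
    have hm : Measurable fun x => ∫⁻ y, ‖(hf.1.mk f) (x, y) - p.1.1 y‖ₑ ^ 2 ∂ν := by
      refine Measurable.lintegral_prod_right' (f := fun z : α × β =>
        ‖(hf.1.mk f) z - p.1.1 z.2‖ₑ ^ 2) ?_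
      exact ((hmeas.sub ((Lp.stronglyMeasurable p.1.1).comp_measurable
        measurable_snd)).enorm).pow_const 2
    have hball : ∀ z : Lp ℂ 2 ν, z ∈ Metric.ball p.1.1 p.1.2 ↔
        ‖z - p.1.1‖ₑ ^ 2 < (ENNReal.ofReal p.1.2) ^ 2 := by
      intro z
      rw [ENNReal.pow_lt_pow_left_iff (by norm_num), mem_ball_iff_norm, ← ofReal_norm,
        ENNReal.ofReal_lt_ofReal_iff_of_nonneg (norm_nonneg _)]
    have : s.indicator (slice ν (hf.1.mk f)) ⁻¹' Metric.ball p.1.1 p.1.2 =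
        (s ∩ {x | ∫⁻ y, ‖(hf.1.mk f) (x, y) - p.1.1 y‖ₑ ^ 2 ∂ν < (ENNReal.ofReal p.1.2) ^ 2}) ∪
        (sᶜ ∩ {_x | (0 : Lp ℂ 2 ν) ∈ Metric.ball p.1.1 p.1.2}) := by
      ext x
      by_cases hx : x ∈ s
      · simp only [Set.mem_preimage, Set.indicator_of_mem hx, hball,
          enorm_slice_sub (hsub.2 x hx)]
        simp [hx]
      · simp [hx]
    rw [this]
    exact (hs.inter (measurableSet_lt hm measurable_const)).union
      (hs.compl.inter (MeasurableSet.const _))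
  refine ⟨_, key.stronglyMeasurable, ?_⟩
  filter_upwards [slice_congr hf.1.ae_eq_mk, hsub.1] with x h1 h2
  rw [h1, Set.indicator_of_mem h2]

theorem lintegral_enorm_slice [SFinite μ] {f : α × β → ℂ} (hf : MemLp f 2 (μ.prod ν)) :
    ∫⁻ x, ‖slice ν f x‖ₑ ^ 2 ∂μ = ∫⁻ z, ‖f z‖ₑ ^ 2 ∂(μ.prod ν) := by
  rw [lintegral_prod _ (hf.1.enorm.pow_const 2)]
  refine lintegral_congr_ae ?_
  filter_upwards [ae_memLp_slice hf] with x hx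
  exact enorm_slice hx

theorem memLp_slice [SFinite μ] {f : α × β → ℂ} (hf : MemLp f 2 (μ.prod ν)) :
    MemLp (slice ν f) 2 μ := by
  rw [memLp_two_iff (aestronglyMeasurable_slice hf), lintegral_enorm_slice hf]
  exact (memLp_two_iff hf.1).1 hf

variable (μ ν) in
/-- The isometry `L²(μ × ν) → L²(μ; L²(ν))`, `f ↦ (x ↦ f(x, ·))`. -/
def lpCurryIsometry [SFinite μ] : Lp ℂ 2 (μ.prod ν) →ₗᵢ[ℂ] Lp (Lp ℂ 2 ν) 2 μ where
  toFun f := (memLp_slice (Lp.memLp f)).toLp _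
  map_add' f g := by
    rw [← MemLp.toLp_add, MemLp.toLp_eq_toLp_iff]
    filter_upwards [slice_congr (Lp.coeFn_add f g), ae_memLp_slice (Lp.memLp f),
      ae_memLp_slice (Lp.memLp g)] with x h h1 h2
    rw [h, Pi.add_apply, slice_of_memLp h1, slice_of_memLp h2, ← MemLp.toLp_add]
    exact slice_of_memLp (f := ⇑f + ⇑g) (h1.add h2)
  map_smul' c f := by
    rw [RingHom.id_apply, ← MemLp.toLp_const_smul, MemLp.toLp_eq_toLp_iff]
    filter_upwards [slice_congr (Lp.coeFn_smul c f), ae_memLp_slice (Lp.memLp f)] with x h h1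
    rw [h, Pi.smul_apply, slice_of_memLp h1, ← MemLp.toLp_const_smul]
    exact slice_of_memLp (f := c • ⇑f) (h1.const_smul c)
  norm_map' f := by
    simp only [LinearMap.coe_mk, AddHom.coe_mk]
    rw [Lp.norm_toLp, Lp.norm_def]
    congr 1
    have h := lintegral_enorm_slice (Lp.memLp f)
    rw [← eLpNorm_two_sq, ← eLpNorm_two_sq] at h
    exact (ENNReal.pow_right_strictMono (n := 2) (by norm_num)).injective h

theorem lpCurryIsometry_surjective [SFinite μ] :
    Function.Surjective (lpCurryIsometry μ ν) := by
  intro g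
  refine Lp.induction (p := 2) (by norm_num)
    (motive := fun g => ∃ f, lpCurryIsometry μ ν f = g) ?_ ?_ ?_ g
  · intro c s hs hμs
    have hc : AEStronglyMeasurable (fun z : α × β => s.indicator (fun _ => (1 : ℂ)) z.1 * c z.2)
        (μ.prod ν) :=
      ((stronglyMeasurable_const.indicator hs).comp_measurable
        measurable_fst).aestronglyMeasurable.mul
        ((Lp.stronglyMeasurable c).comp_measurable measurable_snd).aestronglyMeasurable
    have hmem : MemLp (fun z : α × β => s.indicator (fun _ => (1 : ℂ)) z.1 * c z.2) 2
        (μ.prod ν) := by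
      rw [memLp_two_iff hc, lintegral_prod _ (hc.enorm.pow_const 2)]
      have h1 : ∀ x, ∫⁻ y, ‖s.indicator (fun _ => (1 : ℂ)) x * c y‖ₑ ^ 2 ∂ν =
          s.indicator (fun _ => ∫⁻ y, ‖c y‖ₑ ^ 2 ∂ν) x := by
        intro x
        by_cases hx : x ∈ s <;> simp [hx]
      simp only [h1]
      rw [lintegral_indicator_const hs]
      exact ENNReal.mul_lt_top ((memLp_two_iff (Lp.aestronglyMeasurable c)).1 (Lp.memLp c)) hμs
    refine ⟨hmem.toLp _, ?_⟩
    refine Lp.ext ?_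
    have h1 : (lpCurryIsometry μ ν (hmem.toLp _) : α → Lp ℂ 2 ν) =ᵐ[μ]
        slice ν (hmem.toLp _ : α × β → ℂ) :=
      MemLp.coeFn_toLp (memLp_slice (Lp.memLp (hmem.toLp _)))
    have h2 := slice_congr hmem.coeFn_toLp
    rw [Lp.simpleFunc.coe_indicatorConst]
    filter_upwards [h1, h2, indicatorConstLp_coeFn (p := 2) (hs := hs) (hμs := hμs.ne) (c := c)]
      with x h1 h2 h3
    rw [h1, h2, h3]
    have hx : MemLp (fun y => s.indicator (fun _ => (1 : ℂ)) x * c y) 2 ν :=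
      (Lp.memLp c).const_mul _
    rw [slice_of_memLp (f := fun z : α × β => s.indicator (fun _ => (1 : ℂ)) z.1 * c z.2) hx]
    have : hx.toLp _ = s.indicator (fun _ => (1 : ℂ)) x • c := by
      conv_rhs => rw [← Lp.toLp_coeFn c (Lp.memLp c)]
      rw [← MemLp.toLp_const_smul]
      rfl
    rw [this]
    by_cases h : x ∈ s <;> simp [h]
  · rintro f g hf hg - ⟨a, ha⟩ ⟨b, hb⟩
    exact ⟨a + b, by rw [map_add, ha, hb]⟩
  · exact (lpCurryIsometry μ ν).isometry.isClosedEmbedding.isClosed_range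

variable (μ ν) in
/-- The isometric isomorphism `L²(μ × ν) ≃ L²(μ; L²(ν))`, `f ↦ (x ↦ f(x, ·))`. -/
def lpCurry [SFinite μ] : Lp ℂ 2 (μ.prod ν) ≃ₗᵢ[ℂ] Lp (Lp ℂ 2 ν) 2 μ :=
  LinearIsometryEquiv.ofSurjective (lpCurryIsometry μ ν) lpCurryIsometry_surjective

theorem lpCurry_coeFn [SFinite μ] (f : Lp ℂ 2 (μ.prod ν)) :
    ∀ᵐ x ∂μ, ∀ᵐ y ∂ν, (lpCurry μ ν f x : β → ℂ) y = f (x, y) := by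
  have h1 : (lpCurry μ ν f : α → Lp ℂ 2 ν) =ᵐ[μ] slice ν f :=
    MemLp.coeFn_toLp (memLp_slice (Lp.memLp f))
  filter_upwards [h1, ae_memLp_slice (Lp.memLp f)] with x h1 h2
  rw [h1, slice_of_memLp h2]
  exact h2.coeFn_toLp

end Curry

/-- `ℝⁿ` with its Euclidean inner product `x · y` and Lebesgue measure. -/
abbrev RSpace (n : ℕ) : Type := EuclideanSpace ℝ (Fin n)

/-- `L²(ℝⁿ)`. -/
abbrev L2R (n : ℕ) : Type := Lp ℂ 2 (volume : Measure (RSpace n))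

/-- `L²(ℝ²ⁿ)`, with `ℝ²ⁿ = ℝⁿ × ℝⁿ`. -/
abbrev L2R2 (n : ℕ) : Type :=
  Lp ℂ 2 ((volume : Measure (RSpace n)).prod (volume : Measure (RSpace n)))

instance factTwoNeTop : Fact ((2 : ℝ≥0∞) ≠ ∞) := ⟨by norm_num⟩

variable {n : ℕ}

/-- The integer vector `k ∈ ℤⁿ` as a point of `ℝⁿ`. -/
def intVec (k : Fin n → ℤ) : RSpace n := WithLp.toLp 2 fun i => (k i : ℝ)

theorem memLp_phase_mul {γ : Type*} [MeasurableSpace γ] {ρ : Measure γ} {g : γ → ℂ}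
    (hg : MemLp g 2 ρ) {θ : γ → ℝ} (hθ : Measurable θ) :
    MemLp (fun z => Complex.exp (θ z * Complex.I) * g z) 2 ρ := by
  refine hg.of_le_mul (c := 1) ?_ ?_
  · exact (Complex.measurable_exp.comp
      ((Complex.measurable_ofReal.comp hθ).mul_const _)).aestronglyMeasurable.mul hg.1
  · refine Eventually.of_forall fun z => ?_
    rw [norm_mul, Complex.norm_exp_ofReal_mul_I]

theorem memLp_twistedTranslation (k l : Fin n → ℤ) (f : L2R2 n) :
    MemLp (fun p : RSpace n × RSpace n =>
      Complex.exp ((Real.pi * (⟪p.1, intVec l⟫ - ⟪p.2, intVec k⟫) : ℝ) * Complex.I) *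
        f (p.1 - intVec k, p.2 - intVec l)) 2
      ((volume : Measure (RSpace n)).prod (volume : Measure (RSpace n))) := by
  refine memLp_phase_mul ((Lp.memLp f).comp_measurePreserving
    ((measurePreserving_sub_right volume (intVec k)).prod
      (measurePreserving_sub_right volume (intVec l)))) ?_
  fun_prop

/-- The twisted translation
`T^t_{(k,l)} f(x,y) = e^{πi(x·l - y·k)} f(x - k, y - l)` on `L²(ℝ²ⁿ)`. -/
def twistedTranslation (k l : Fin n → ℤ) (f : L2R2 n) : L2R2 n :=
  (memLp_twistedTranslation k l f).toLp _

/-- The inverse Fourier transform in the first variable,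
`(s, y) ↦ ∫ f(x, y) e^{2πi x·s} dx`, on `L²(ℝ²ⁿ)`. -/
def partialFourierInv (f : L2R2 n) : L2R2 n :=
  (lpCurry volume volume).symm (𝓕⁻ (lpCurry volume volume f))

theorem measurePreserving_weyl :
    MeasurePreserving (fun p : RSpace n × RSpace n => ((1 / 2 : ℝ) • (p.1 + p.2), p.2 - p.1))
      (volume.prod volume) (volume.prod volume) := by
  have h1 : MeasurePreserving (fun p : RSpace n × RSpace n => (p.1, p.2 - p.1))
      (volume.prod volume) (volume.prod volume) :=
    MeasurePreserving.skew_product (MeasurePreserving.id volume) (g := fun a b => b - a)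
      (by fun_prop)
      (Eventually.of_forall fun a => (measurePreserving_sub_right volume a).map_eq)
  have h2 : MeasurePreserving (fun p : RSpace n × RSpace n => (p.1, p.2 + (1 / 2 : ℝ) • p.1))
      (volume.prod volume) (volume.prod volume) :=
    MeasurePreserving.skew_product (MeasurePreserving.id volume)
      (g := fun a b => b + (1 / 2 : ℝ) • a) (by fun_prop)
      (Eventually.of_forall fun a =>
        (measurePreserving_add_right volume ((1 / 2 : ℝ) • a)).map_eq)
  have h3 := Measure.measurePreserving_swap.comp (h2.comp (Measure.measurePreserving_swap.comp h1))
  convert h3 using 1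
  funext p
  simp only [Function.comp, Prod.swap]
  refine Prod.ext ?_ rfl
  simp only
  module

/-- The kernel `K_f(ξ, η) = ∫ f(x, η - ξ) e^{πi x·(ξ+η)} dx` of the Weyl transform of
`f ∈ L²(ℝ²ⁿ)`: the integral, taken in the `L²` sense, is the inverse Fourier transform of `f` in
its first variable, evaluated at `((ξ + η)/2, η - ξ)`. -/
def weylKernel (f : L2R2 n) : L2R2 n :=
  Lp.compMeasurePreserving _ measurePreserving_weyl (partialFourierInv f)

/-- The torus `𝕋ⁿ`, realised as `[0,1)ⁿ ⊆ ℝⁿ` with Lebesgue measure. -/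
def torusMeasure (n : ℕ) : Measure (RSpace n) :=
  volume.restrict {x | ∀ i, x i ∈ Set.Ico (0 : ℝ) 1}

/-- The measure on `𝕋ⁿ × 𝕋ⁿ`. -/
def torusMeasure2 (n : ℕ) : Measure (RSpace n × RSpace n) :=
  (torusMeasure n).prod (torusMeasure n)

instance isProbabilityMeasure_torusMeasure (n : ℕ) : IsProbabilityMeasure (torusMeasure n) := by
  refine ⟨?_⟩
  rw [torusMeasure, Measure.restrict_apply_univ]
  have h := (PiLp.volume_preserving_ofLp (Fin n)).measure_preimage
    (MeasurableSet.univ_pi fun _ : Fin n =>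
      (measurableSet_Ico : MeasurableSet (Set.Ico (0 : ℝ) 1))).nullMeasurableSet
  have hs : {x : RSpace n | ∀ i, x i ∈ Set.Ico (0 : ℝ) 1} =
      (WithLp.ofLp : RSpace n → Fin n → ℝ) ⁻¹' Set.univ.pi fun _ => Set.Ico (0 : ℝ) 1 := by
    ext x
    simp
  rw [hs, h, Real.volume_pi_Ico]
  simp

instance sFinite_torusMeasure2 (n : ℕ) : SFinite (torusMeasure2 n) := by unfold torusMeasure2; infer_instance

theorem memLp_zakTerm (m : Fin n → ℤ) (K : L2R2 n) :
    MemLp (fun p : (RSpace n × RSpace n) × RSpace n =>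
      Complex.exp ((-2 * Real.pi * ⟪intVec m, p.1.2⟫ : ℝ) * Complex.I) *
        K (intVec m + p.1.1, p.2)) 2 ((torusMeasure2 n).prod volume) := by
  have h1 : MemLp (fun q : RSpace n × RSpace n => K (intVec m + q.1, q.2)) 2
      (volume.prod volume) :=
    (Lp.memLp K).comp_measurePreserving
      ((measurePreserving_add_left volume (intVec m)).prod (MeasurePreserving.id volume))
  have h2 : MemLp (fun q : RSpace n × RSpace n => K (intVec m + q.1, q.2)) 2
      ((torusMeasure n).prod volume) := by
    refine h1.mono_measure ?_
    have h : (torusMeasure n).prod (volume : Measure (RSpace n)) = (volume.prod volume).restrict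
        ({x : RSpace n | ∀ i, x i ∈ Set.Ico (0 : ℝ) 1} ×ˢ Set.univ) := by
      rw [← Measure.prod_restrict, Measure.restrict_univ, torusMeasure]
    rw [h]
    exact Measure.restrict_le_self
  have h3 : MeasurePreserving (Prod.map Prod.fst id)
      ((torusMeasure2 n).prod (volume : Measure (RSpace n))) ((torusMeasure n).prod volume) :=
    measurePreserving_fst.prod (MeasurePreserving.id volume)
  refine memLp_phase_mul (h2.comp_measurePreserving h3) ?_
  fun_prop

/-- The function `(ξ, ξ', η) ↦ e^{-2πi m·ξ'} K(m + ξ, η)` on `𝕋ⁿ × 𝕋ⁿ × ℝⁿ`. -/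
def zakTerm (m : Fin n → ℤ) (K : L2R2 n) :
    Lp ℂ 2 ((torusMeasure2 n).prod (volume : Measure (RSpace n))) :=
  (memLp_zakTerm m K).toLp _

/-- The Weyl-Zak transform
`Z_W f(ξ, ξ', η) = ∑_{m ∈ ℤⁿ} K_f(m + ξ, η) e^{-2πi m·ξ'}`, the series being summed in
`L²(𝕋ⁿ × 𝕋ⁿ × ℝⁿ)`. -/
def weylZak (f : L2R2 n) : Lp ℂ 2 ((torusMeasure2 n).prod (volume : Measure (RSpace n))) :=
  ∑' m : Fin n → ℤ, zakTerm m (weylKernel f)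

/-- The map `𝒥 : L²(ℝ²ⁿ) → L²(𝕋ⁿ × 𝕋ⁿ; L²(ℝⁿ))`, `𝒥 f(ξ, ξ')(η) = Z_W f(ξ, ξ', η)`. -/
def calJ (f : L2R2 n) : Lp (L2R n) 2 (torusMeasure2 n) :=
  lpCurry (torusMeasure2 n) volume (weylZak f)

/-- Twisted shift-invariant spaces: closed subspaces of `L²(ℝ²ⁿ)` that are invariant under all
twisted translations `T^t_{(k,l)}`, `k, l ∈ ℤⁿ`. -/
structure IsTwistedShiftInvariant (V : Submodule ℂ (L2R2 n)) : Prop where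
  isClosed : IsClosed (V : Set (L2R2 n))
  translation_mem : ∀ (k l : Fin n → ℤ), ∀ f ∈ V, twistedTranslation k l f ∈ V

/-- Twisted shift preserving operators: bounded operators `U : V → L²(ℝ²ⁿ)` with
`U T^t_{(k,l)} = T^t_{(k,l)} U` on `V` for all `k, l ∈ ℤⁿ`. -/
def IsTwistedShiftPreserving {V : Submodule ℂ (L2R2 n)} (hV : IsTwistedShiftInvariant V)
    (U : V →L[ℂ] L2R2 n) : Prop :=
  ∀ (k l : Fin n → ℤ) (f : V),
    U ⟨twistedTranslation k l f, hV.translation_mem k l f f.2⟩ = twistedTranslation k l (U f)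

/-- `J` is the range function of `V`: `J(ξ, ξ')` is the closed linear span of the vectors
`𝒥 f(ξ, ξ')`, `f ∈ V`. As each `𝒥 f` is defined only almost everywhere, `f` has to run through a
countable dense subset of `V`; up to equality almost everywhere, `J` does not depend on it. -/
def IsRangeFunction (V : Submodule ℂ (L2R2 n))
    (J : RSpace n × RSpace n → ClosedSubmodule ℂ (L2R n)) : Prop :=
  ∃ A : Set (L2R2 n), A.Countable ∧ A ⊆ V ∧ (V : Set (L2R2 n)) ⊆ closure A ∧
    ∀ᵐ ω ∂(torusMeasure2 n), J ω = (Submodule.span ℂ ((fun f => calJ f ω) '' A)).closure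

/-- Range operators on `J`: families of bounded operators `R(ξ, ξ') : J(ξ, ξ') → L²(ℝⁿ)`. -/
abbrev RangeOperator (J : RSpace n × RSpace n → ClosedSubmodule ℂ (L2R n)) : Type :=
  ∀ ω, (J ω).toSubmodule →L[ℂ] L2R n

/-- `R` is measurable: with `P(ξ, ξ')` the orthogonal projection onto `J(ξ, ξ')`, the function
`(ξ, ξ') ↦ ⟨R(ξ, ξ') P(ξ, ξ') a, b⟩` is (Lebesgue) measurable for all `a, b ∈ L²(ℝⁿ)`. -/
def IsMeasurableRangeOperator {J : RSpace n × RSpace n → ClosedSubmodule ℂ (L2R n)}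
    (R : RangeOperator J) : Prop :=
  ∀ a b : L2R n, AEMeasurable
    (fun ω => inner ℂ b (R ω ((J ω).toSubmodule.orthogonalProjectionOnto a))) (torusMeasure2 n)

/-- `ess sup ‖R(ξ, ξ')‖ < ∞`. -/
def IsEssBounded {J : RSpace n × RSpace n → ClosedSubmodule ℂ (L2R n)}
    (R : RangeOperator J) : Prop :=
  ∃ C : ℝ, ∀ᵐ ω ∂(torusMeasure2 n), ‖R ω‖ ≤ C

/-- For every `f ∈ V`, `(𝒥 ∘ U) f(ξ, ξ') = R(ξ, ξ') (𝒥 f(ξ, ξ'))` for a.e. `(ξ, ξ')`. This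
includes that `𝒥 f(ξ, ξ')` lies in the domain `J(ξ, ξ')` of `R(ξ, ξ')` for a.e. `(ξ, ξ')`. -/
def Corresponds {V : Submodule ℂ (L2R2 n)}
    {J : RSpace n × RSpace n → ClosedSubmodule ℂ (L2R n)}
    (U : V →L[ℂ] L2R2 n) (R : RangeOperator J) : Prop :=
  ∀ f : V, ∀ᵐ ω ∂(torusMeasure2 n), ∃ h : calJ (f : L2R2 n) ω ∈ (J ω).toSubmodule,
    calJ (U f) ω = R ω ⟨calJ (f : L2R2 n) ω, h⟩

end TwistedShift
end

/-!
The transform `𝒥` is unitary and turns the twisted translation `T^t_{(k,l)}` into multiplication by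
the character `e^{2πi(k·ξ + l·ξ')}` of `𝕋ⁿ × 𝕋ⁿ`, up to a unimodular constant
(`calJ_twistedTranslation`, `calJ_surjective`). For the Weyl kernel this is the exchange of
translations and modulations by the Fourier transform; the Zak transform is isometric because its
terms are pairwise orthogonal and their squared norms add up over the unit cells; and the range of `𝒥`
contains the constant functions and is stable under multiplication by characters, hence is
everything.

An integrable function on `𝕋ⁿ × 𝕋ⁿ` is determined by its Fourier coefficients
(`ae_eq_zero_of_forall_integral_char_mul_eq_zero`). Applied to the functions
`ω ↦ ⟨𝒥h(ω), 𝒥f(ω)⟩`, this shows that `𝒥V` is invariant under multiplication by indicators, that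
the projection onto `𝒥V` acts fibrewise as the projections onto the `J(ω)`, and that a twisted
shift preserving `U` commutes with multiplication by indicators. Integrating over arbitrary sets
gives the fibrewise bound `‖𝒥Uf(ω)‖ ≤ ‖U‖ ‖𝒥f(ω)‖` (`ae_norm_calJ_apply_le`).

By this bound, for almost every `ω` the assignment `𝒥f(ω) ↦ 𝒥Uf(ω)`, with `f` in a countable dense
subset of `V`, extends to a bounded operator `R(ω)` on `J(ω)` (`exists_rangeOperator`); the
relation `𝒥Uf(ω) = R(ω) 𝒥f(ω)` passes to all of `V` by approximation, and `R(ω)` is determined by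
its values on the generators of `J(ω)`.
Conversely, an essentially bounded measurable range operator defines the bounded operator
`F ↦ R(·) P(·) F(·)` on `L²(𝕋ⁿ × 𝕋ⁿ; L²(ℝⁿ))`, which commutes with the characters, and
`U = 𝒥⁻¹ R P 𝒥` (`exists_twistedShiftPreserving`).
-/

noncomputable section

set_option linter.unusedSectionVars false

namespace TwistedShift

/-! ### Multiplication by unimodular functions -/

section Phase

variable {α : Type*} [MeasurableSpace α] {μ : Measure α} {F : Type*} [NormedAddCommGroup F]
  [NormedSpace ℂ F]

theorem memLp_phase_smul {g : α → F} (hg : MemLp g 2 μ) {θ : α → ℝ} (hθ : Measurable θ) :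
    MemLp (fun x => Complex.exp (θ x * Complex.I) • g x) 2 μ := by
  refine hg.of_le_mul (c := 1) ?_ ?_
  · exact (Complex.measurable_exp.comp
      ((Complex.measurable_ofReal.comp hθ).mul_const _)).aestronglyMeasurable.smul hg.1
  · refine Eventually.of_forall fun x => ?_
    rw [norm_smul, Complex.norm_exp_ofReal_mul_I]

/-- Multiplication by the unimodular function `e^{iθ}` on `L²(μ; F)`. -/
def phaseMul (θ : α → ℝ) (hθ : Measurable θ) : Lp F 2 μ →ₗᵢ[ℂ] Lp F 2 μ where
  toFun f := (memLp_phase_smul (Lp.memLp f) hθ).toLp _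
  map_add' f g := by
    rw [← MemLp.toLp_add, MemLp.toLp_eq_toLp_iff]
    filter_upwards [Lp.coeFn_add f g] with x h
    rw [h, Pi.add_apply, smul_add, Pi.add_apply]
  map_smul' c f := by
    rw [RingHom.id_apply, ← MemLp.toLp_const_smul, MemLp.toLp_eq_toLp_iff]
    filter_upwards [Lp.coeFn_smul c f] with x h
    simp only [h, Pi.smul_apply]
    rw [smul_comm]
  norm_map' f := by
    simp only [LinearMap.coe_mk, AddHom.coe_mk]
    rw [Lp.norm_toLp, Lp.norm_def]
    congr 1
    refine eLpNorm_congr_norm_ae (Eventually.of_forall fun x => ?_)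
    rw [norm_smul, Complex.norm_exp_ofReal_mul_I, one_mul]

theorem coeFn_phaseMul (θ : α → ℝ) (hθ : Measurable θ) (f : Lp F 2 μ) :
    phaseMul θ hθ f =ᵐ[μ] fun x => Complex.exp (θ x * Complex.I) • f x :=
  MemLp.coeFn_toLp (memLp_phase_smul (Lp.memLp f) hθ)

end Phase

/-! ### Translations, modulations and the `L²` Fourier transform -/

section Fourier

variable {E F : Type*} [NormedAddCommGroup E] [InnerProductSpace ℝ E] [FiniteDimensional ℝ E]
  [MeasurableSpace E] [BorelSpace E]
  [NormedAddCommGroup F] [InnerProductSpace ℂ F] [CompleteSpace F]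

variable (F) in
/-- The translation `f ↦ f(· - a)` on `L²(E; F)`. -/
def lpTranslate (a : E) : Lp F 2 (volume : Measure E) →ₗᵢ[ℂ] Lp F 2 (volume : Measure E) :=
  Lp.compMeasurePreservingₗᵢ ℂ (fun x => x - a) (measurePreserving_sub_right volume a)

theorem coeFn_lpTranslate (a : E) (f : Lp F 2 (volume : Measure E)) :
    lpTranslate F a f =ᵐ[volume] fun x => f (x - a) :=
  Lp.coeFn_compMeasurePreserving f (measurePreserving_sub_right volume a)

theorem lpTranslate_toLp (a : E) (φ : SchwartzMap E F) :
    lpTranslate F a (φ.toLp 2) = (φ.compSubConstCLM ℂ a).toLp 2 := by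
  refine Lp.ext ?_
  filter_upwards [coeFn_lpTranslate a (φ.toLp 2), (φ.compSubConstCLM ℂ a).coeFn_toLp 2,
    (measurePreserving_sub_right volume a).quasiMeasurePreserving.ae (φ.coeFn_toLp 2 volume)]
    with x h1 h2 h3
  rw [h1, h2, h3, SchwartzMap.compSubConstCLM_apply]

theorem fourier_lpTranslate (a : E) (f : Lp F 2 (volume : Measure E)) :
    𝓕 (lpTranslate F a f) =
      phaseMul (fun s => -(2 * Real.pi * ⟪a, s⟫)) (by fun_prop) (𝓕 f) := by
  revert f
  refine (SchwartzMap.denseRange_toLpCLM (p := 2) (by simp)).induction ?_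
    (isClosed_eq (by fun_prop) (by fun_prop))
  rintro _ ⟨φ, rfl⟩
  rw [SchwartzMap.toLpCLM_apply, lpTranslate_toLp, SchwartzMap.toLp_fourier_eq,
    SchwartzMap.toLp_fourier_eq]
  refine Lp.ext ?_
  filter_upwards [(𝓕 (φ.compSubConstCLM ℂ a)).coeFn_toLp 2,
    coeFn_phaseMul (fun s => -(2 * Real.pi * ⟪a, s⟫)) (by fun_prop) ((𝓕 φ).toLp 2 volume),
    (𝓕 φ).coeFn_toLp 2] with s h1 h2 h3
  rw [h1, h2, h3, SchwartzMap.fourier_coe, SchwartzMap.fourier_coe, Real.fourier_eq',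
    Real.fourier_eq', ← integral_smul]
  rw [← integral_sub_right_eq_self (fun v => Complex.exp _ • Complex.exp _ • φ v) a]
  congr 1 with v
  rw [SchwartzMap.compSubConstCLM_apply, smul_smul, ← Complex.exp_add, inner_sub_left]
  congr 2
  push_cast
  ring

theorem fourierInv_lpTranslate (a : E) (f : Lp F 2 (volume : Measure E)) :
    𝓕⁻ (lpTranslate F a f) =
      phaseMul (fun s => 2 * Real.pi * ⟪a, s⟫) (by fun_prop) (𝓕⁻ f) := by
  revert f
  refine (SchwartzMap.denseRange_toLpCLM (p := 2) (by simp)).induction ?_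
    (isClosed_eq (by fun_prop) (by fun_prop))
  rintro _ ⟨φ, rfl⟩
  rw [SchwartzMap.toLpCLM_apply, lpTranslate_toLp, SchwartzMap.toLp_fourierInv_eq,
    SchwartzMap.toLp_fourierInv_eq]
  refine Lp.ext ?_
  filter_upwards [(𝓕⁻ (φ.compSubConstCLM ℂ a)).coeFn_toLp 2,
    coeFn_phaseMul (fun s => 2 * Real.pi * ⟪a, s⟫) (by fun_prop) ((𝓕⁻ φ).toLp 2 volume),
    (𝓕⁻ φ).coeFn_toLp 2] with s h1 h2 h3
  rw [h1, h2, h3, SchwartzMap.fourierInv_coe, SchwartzMap.fourierInv_coe, Real.fourierInv_eq',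
    Real.fourierInv_eq', ← integral_smul]
  rw [← integral_sub_right_eq_self (fun v => Complex.exp _ • Complex.exp _ • φ v) a]
  congr 1 with v
  rw [SchwartzMap.compSubConstCLM_apply, smul_smul, ← Complex.exp_add, inner_sub_left]
  congr 2
  push_cast
  ring

/-- Read backwards through the Fourier inversion formula, this is `fourier_lpTranslate`. -/
theorem fourierInv_phaseMul (b : E) (f : Lp F 2 (volume : Measure E)) :
    𝓕⁻ (phaseMul (fun s => 2 * Real.pi * ⟪b, s⟫) (by fun_prop) f) =
      lpTranslate F (-b) (𝓕⁻ f) := by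
  have h := fourier_lpTranslate (-b) (𝓕⁻ f)
  simp only [inner_neg_left, mul_neg, neg_neg, FourierTransform.fourier_fourierInv_eq] at h
  rw [← h, FourierTransform.fourierInv_fourier_eq]

theorem fourierInv_compLp (A : F →L[ℂ] F) (f : Lp F 2 (volume : Measure E)) :
    𝓕⁻ (A.compLpL 2 volume f) = A.compLpL 2 volume (𝓕⁻ f) := by
  revert f
  refine (SchwartzMap.denseRange_toLpCLM (p := 2) (by simp)).induction ?_
    (isClosed_eq (by fun_prop) (by fun_prop))
  rintro _ ⟨φ, rfl⟩
  have key : ∀ ψ : SchwartzMap E F,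
      A.compLpL 2 volume (ψ.toLp 2) = (ψ.postcompCLM A).toLp 2 := by
    intro ψ
    refine Lp.ext ?_
    filter_upwards [A.coeFn_compLpL (p := 2) (ψ.toLp 2 volume), (ψ.postcompCLM A).coeFn_toLp 2,
      ψ.coeFn_toLp 2] with x h1 h2 h3
    rw [h1, h2, h3, SchwartzMap.postcompCLM_apply]
  rw [SchwartzMap.toLpCLM_apply, key, SchwartzMap.toLp_fourierInv_eq,
    SchwartzMap.toLp_fourierInv_eq, key]
  congr 1
  ext s
  rw [SchwartzMap.postcompCLM_apply, SchwartzMap.fourierInv_coe, SchwartzMap.fourierInv_coe,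
    Real.fourierInv_eq', Real.fourierInv_eq', ← A.integral_comp_comm]
  · simp
  · have := (Real.fourierIntegral_convergent_iff (-s)).2 (φ.integrable (μ := volume))
    refine this.congr (Eventually.of_forall fun v => ?_)
    simp [Real.fourierChar_apply, Circle.smul_def]

end Fourier

/-! ### The Weyl kernel -/

section WeylKernel

variable {n : ℕ}

/-- The translation `f ↦ f(· - a, · - b)` on `L²(ℝ²ⁿ)`. -/
def prodTranslate (a b : RSpace n) : L2R2 n →ₗᵢ[ℂ] L2R2 n :=
  Lp.compMeasurePreservingₗᵢ ℂ (fun p => (p.1 - a, p.2 - b))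
    ((measurePreserving_sub_right volume a).prod (measurePreserving_sub_right volume b))

theorem coeFn_prodTranslate (a b : RSpace n) (f : L2R2 n) :
    prodTranslate a b f =ᵐ[volume.prod volume] fun p => f (p.1 - a, p.2 - b) :=
  Lp.coeFn_compMeasurePreserving f
    ((measurePreserving_sub_right volume a).prod (measurePreserving_sub_right volume b))

/-- The operator `v ↦ e^{iθ} v(· - b)` on `L²(ℝⁿ)`. -/
def phaseTranslate (θ : RSpace n → ℝ) (hθ : Measurable θ) (b : RSpace n) : L2R n →L[ℂ] L2R n :=
  (phaseMul θ hθ).toContinuousLinearMap ∘L (lpTranslate ℂ b).toContinuousLinearMap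

theorem coeFn_phaseTranslate (θ : RSpace n → ℝ) (hθ : Measurable θ) (b : RSpace n) (v : L2R n) :
    phaseTranslate θ hθ b v =ᵐ[volume] fun y => Complex.exp (θ y * Complex.I) * v (y - b) := by
  filter_upwards [coeFn_phaseMul θ hθ (lpTranslate ℂ b v), coeFn_lpTranslate b v] with y h1 h2
  exact h1.trans (by rw [h2, smul_eq_mul])

/-- Under `L²(ℝ²ⁿ) ≃ L²(ℝⁿ; L²(ℝⁿ))`, the action on the second variable becomes an operator on the
values. -/
theorem lpCurry_phaseMul_prodTranslate (θ₁ θ₂ : RSpace n → ℝ) (h₁ : Measurable θ₁)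
    (h₂ : Measurable θ₂) (a b : RSpace n) (f : L2R2 n) :
    lpCurry volume volume
        (phaseMul (fun p => θ₁ p.1 + θ₂ p.2) (by fun_prop) (prodTranslate a b f)) =
      phaseMul θ₁ h₁ ((phaseTranslate θ₂ h₂ b).compLpL 2 volume
        (lpTranslate (L2R n) a (lpCurry volume volume f))) := by
  set g := phaseMul (fun p : RSpace n × RSpace n => θ₁ p.1 + θ₂ p.2) (by fun_prop)
    (prodTranslate a b f)
  have hg : g =ᵐ[volume.prod volume] fun p =>
      Complex.exp ((θ₁ p.1 + θ₂ p.2 : ℝ) * Complex.I) * f (p.1 - a, p.2 - b) := by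
    filter_upwards [coeFn_phaseMul (fun p : RSpace n × RSpace n => θ₁ p.1 + θ₂ p.2) (by fun_prop)
      (prodTranslate a b f), coeFn_prodTranslate a b f] with p h1 h2
    exact h1.trans (by rw [h2, smul_eq_mul])
  refine Lp.ext ?_
  filter_upwards [lpCurry_coeFn g, Measure.ae_ae_of_ae_prod hg,
    coeFn_phaseMul θ₁ h₁ ((phaseTranslate θ₂ h₂ b).compLpL 2 volume
      (lpTranslate (L2R n) a (lpCurry volume volume f))),
    (phaseTranslate θ₂ h₂ b).coeFn_compLpL (p := 2)
      (lpTranslate (L2R n) a (lpCurry volume volume f)),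
    coeFn_lpTranslate a (lpCurry volume volume f),
    (measurePreserving_sub_right volume a).quasiMeasurePreserving.ae (lpCurry_coeFn f)]
    with x x1 x2 x3 x4 x5 x6
  rw [x3, x4, x5]
  refine Lp.ext ?_
  filter_upwards [x1, x2, Lp.coeFn_smul (Complex.exp (θ₁ x * Complex.I))
      (phaseTranslate θ₂ h₂ b (lpCurry volume volume f (x - a))),
    coeFn_phaseTranslate θ₂ h₂ b (lpCurry volume volume f (x - a)),
    (measurePreserving_sub_right volume b).quasiMeasurePreserving.ae x6] with y y1 y2 y3 y4 y5
  rw [y1, y2, y3, Pi.smul_apply, y4, y5, smul_eq_mul, ← mul_assoc, ← Complex.exp_add]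
  push_cast
  ring_nf

theorem twistedTranslation_eq (k l : Fin n → ℤ) (f : L2R2 n) :
    twistedTranslation k l f =
      phaseMul (fun p => 2 * Real.pi * ⟪(1 / 2 : ℝ) • intVec l, p.1⟫ +
        -(Real.pi * ⟪p.2, intVec k⟫)) (by fun_prop)
        (prodTranslate (intVec k) (intVec l) f) := by
  refine Lp.ext ?_
  filter_upwards [(memLp_twistedTranslation k l f).coeFn_toLp,
    coeFn_phaseMul (fun p : RSpace n × RSpace n => 2 * Real.pi * ⟪(1 / 2 : ℝ) • intVec l, p.1⟫ +
        -(Real.pi * ⟪p.2, intVec k⟫)) (by fun_prop) (prodTranslate (intVec k) (intVec l) f),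
    coeFn_prodTranslate (intVec k) (intVec l) f] with p h1 h2 h3
  refine h1.trans (Eq.trans ?_ h2.symm)
  rw [h3, smul_eq_mul]
  congr 3
  rw [real_inner_smul_left, real_inner_comm]
  push_cast
  ring

/-- The inverse Fourier transform turns a translation by `a` followed by an operator on the values
and a modulation by `c` into the operator on the values, a translation by `-c` and a modulation. -/
theorem fourierInv_phaseMul_compLp_lpTranslate (A : L2R n →L[ℂ] L2R n) (a c : RSpace n)
    (g : Lp (L2R n) 2 (volume : Measure (RSpace n))) :
    𝓕⁻ (phaseMul (fun x => 2 * Real.pi * ⟪c, x⟫) (by fun_prop)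
        (A.compLpL 2 volume (lpTranslate (L2R n) a g))) =
      phaseMul (fun s => 2 * Real.pi * ⟪a, s + c⟫) (by fun_prop)
        (A.compLpL 2 volume (lpTranslate (L2R n) (-c) (𝓕⁻ g))) := by
  rw [fourierInv_phaseMul, fourierInv_compLp, fourierInv_lpTranslate]
  generalize 𝓕⁻ g = G
  generalize hH : phaseMul (fun s => 2 * Real.pi * ⟪a, s⟫) (by fun_prop) G = H
  have hG := coeFn_phaseMul (fun s => 2 * Real.pi * ⟪a, s⟫) (by fun_prop) G
  rw [hH] at hG
  refine Lp.ext ?_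
  have hmp :=
    (measurePreserving_sub_right (volume : Measure (RSpace n)) (-c)).quasiMeasurePreserving
  filter_upwards [coeFn_lpTranslate (-c) (A.compLpL 2 volume H),
    hmp.ae (A.coeFn_compLpL (p := 2) H), hmp.ae hG,
    coeFn_phaseMul (fun x => 2 * Real.pi * ⟪a, x + c⟫) (by fun_prop)
      (A.compLpL 2 volume (lpTranslate (L2R n) (-c) G)),
    A.coeFn_compLpL (p := 2) (lpTranslate (L2R n) (-c) G), coeFn_lpTranslate (-c) G]
    with s h1 h2 h3 h4 h5 h6
  rw [h1, h2, h3, h4, h5, h6, map_smul, sub_neg_eq_add]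

theorem partialFourierInv_twistedTranslation (k l : Fin n → ℤ) (f : L2R2 n) :
    partialFourierInv (twistedTranslation k l f) =
      phaseMul (fun p => 2 * Real.pi * ⟪intVec k, p.1 + (1 / 2 : ℝ) • intVec l⟫ +
        -(Real.pi * ⟪p.2, intVec k⟫)) (by fun_prop)
        (prodTranslate (-((1 / 2 : ℝ) • intVec l)) (intVec l) (partialFourierInv f)) := by
  have h1 := lpCurry_phaseMul_prodTranslate
    (fun x => 2 * Real.pi * ⟪(1 / 2 : ℝ) • intVec l, x⟫) (fun y => -(Real.pi * ⟪y, intVec k⟫))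
    (by fun_prop) (by fun_prop) (intVec k) (intVec l) f
  have h2 := lpCurry_phaseMul_prodTranslate
    (fun x => 2 * Real.pi * ⟪intVec k, x + (1 / 2 : ℝ) • intVec l⟫)
    (fun y => -(Real.pi * ⟪y, intVec k⟫)) (by fun_prop) (by fun_prop)
    (-((1 / 2 : ℝ) • intVec l)) (intVec l) (partialFourierInv f)
  have h3 : lpCurry volume volume (partialFourierInv f) = 𝓕⁻ (lpCurry volume volume f) :=
    LinearIsometryEquiv.apply_symm_apply _ _
  rw [h3, ← fourierInv_phaseMul_compLp_lpTranslate, ← h1, ← twistedTranslation_eq] at h2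
  exact ((LinearIsometryEquiv.eq_symm_apply _).2 h2).symm

/-- `K_{T^t_{(k,l)} f}(ξ, η) = e^{πi k·l} e^{2πi k·ξ} K_f(ξ + l, η)`. -/
theorem weylKernel_twistedTranslation (k l : Fin n → ℤ) (f : L2R2 n) :
    weylKernel (twistedTranslation k l f) =ᵐ[volume.prod volume] fun p =>
      Complex.exp ((Real.pi * ⟪intVec k, intVec l⟫ + 2 * Real.pi * ⟪intVec k, p.1⟫ : ℝ) *
        Complex.I) * weylKernel f (intVec l + p.1, p.2) := by
  have hw := (measurePreserving_weyl (n := n)).quasiMeasurePreserving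
  have ht : MeasurePreserving (fun p : RSpace n × RSpace n => (intVec l + p.1, p.2))
      (volume.prod volume) (volume.prod volume) :=
    (measurePreserving_add_left volume (intVec l)).prod (MeasurePreserving.id volume)
  have h1 := Lp.coeFn_compMeasurePreserving (partialFourierInv (twistedTranslation k l f))
    (measurePreserving_weyl (n := n))
  have h2 := Lp.coeFn_compMeasurePreserving (partialFourierInv f) (measurePreserving_weyl (n := n))
  rw [partialFourierInv_twistedTranslation] at h1
  filter_upwards [h1, ht.quasiMeasurePreserving.ae h2,
    hw.ae (coeFn_phaseMul (fun p : RSpace n × RSpace n =>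
        2 * Real.pi * ⟪intVec k, p.1 + (1 / 2 : ℝ) • intVec l⟫ + -(Real.pi * ⟪p.2, intVec k⟫))
      (by fun_prop) (prodTranslate (-((1 / 2 : ℝ) • intVec l)) (intVec l) (partialFourierInv f))),
    hw.ae (coeFn_prodTranslate (-((1 / 2 : ℝ) • intVec l)) (intVec l) (partialFourierInv f))]
    with p e1 e2 e3 e4
  rw [weylKernel, weylKernel, partialFourierInv_twistedTranslation, e1, e2, Function.comp_apply,
    e3, e4, Function.comp_apply, smul_eq_mul]
  congr 1
  · congr 3
    rw [real_inner_comm (intVec k), inner_add_right, inner_smul_right, inner_smul_right,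
      inner_add_right, inner_sub_right]
    ring
  · congr 2
    · module
    · module

variable (n) in
/-- The map `f ↦ K_f` as a linear isometry. -/
def weylKernelIsometry : L2R2 n →ₗᵢ[ℂ] L2R2 n :=
  (Lp.compMeasurePreservingₗᵢ ℂ _ measurePreserving_weyl).comp
    (((lpCurry volume volume).trans (Lp.fourierTransformₗᵢ (RSpace n) (L2R n)).symm).trans
      (lpCurry volume volume).symm).toLinearIsometry

theorem weylKernel_surjective : Function.Surjective (weylKernel (n := n)) := by
  -- the substitution `(ξ, η) ↦ ((ξ + η)/2, η - ξ)` is invertible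
  let e : (RSpace n × RSpace n) ≃ᵐ (RSpace n × RSpace n) :=
    { toFun := fun p => ((1 / 2 : ℝ) • (p.1 + p.2), p.2 - p.1)
      invFun := fun q => (q.1 - (1 / 2 : ℝ) • q.2, q.1 + (1 / 2 : ℝ) • q.2)
      left_inv := fun p => by ext1 <;> simp only <;> module
      right_inv := fun q => by ext1 <;> simp only <;> module
      measurable_toFun := by
        simp only [Equiv.coe_fn_mk]
        fun_prop
      measurable_invFun := by
        simp only [Equiv.coe_fn_symm_mk]
        fun_prop }
  have he : MeasurePreserving e (volume.prod volume) (volume.prod volume) := measurePreserving_weyl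
  intro K
  let g : L2R2 n := Lp.compMeasurePreserving _ (he.symm e) K
  refine ⟨(((lpCurry volume volume).trans (Lp.fourierTransformₗᵢ (RSpace n) (L2R n)).symm).trans
      (lpCurry volume volume).symm).symm g, ?_⟩
  have h : partialFourierInv ((((lpCurry volume volume).trans
      (Lp.fourierTransformₗᵢ (RSpace n) (L2R n)).symm).trans
      (lpCurry volume volume).symm).symm g) = g :=
    LinearIsometryEquiv.apply_symm_apply (((lpCurry volume volume).trans
      (Lp.fourierTransformₗᵢ (RSpace n) (L2R n)).symm).trans
      (lpCurry volume volume).symm) g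
  rw [weylKernel, h]
  refine Lp.ext ?_
  filter_upwards [Lp.coeFn_compMeasurePreserving g (measurePreserving_weyl (n := n)),
    he.quasiMeasurePreserving.ae (Lp.coeFn_compMeasurePreserving K (he.symm e))] with p h1 h2
  rw [h1, Function.comp_apply]
  refine h2.trans ?_
  rw [Function.comp_apply, MeasurableEquiv.symm_apply_apply]

end WeylKernel

/-! ### The Weyl-Zak transform is isometric -/

section Zak

variable {n : ℕ}

theorem inner_intVec (k m : Fin n → ℤ) : ⟪intVec k, intVec m⟫ = ((∑ i, k i * m i : ℤ) : ℝ) := by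
  simp [intVec, PiLp.inner_apply, mul_comm]

theorem intVec_add (k m : Fin n → ℤ) : intVec (k + m) = intVec k + intVec m := by
  ext i
  simp [intVec]

theorem intVec_sub (k m : Fin n → ℤ) : intVec (k - m) = intVec k - intVec m := by
  ext i
  simp [intVec]

theorem measurableSet_cube (n : ℕ) :
    MeasurableSet {x : RSpace n | ∀ i, x i ∈ Set.Ico (0 : ℝ) 1} := by
  rw [Set.ofPred_forall]
  exact MeasurableSet.iInter fun i => measurableSet_Ico.preimage (by fun_prop)

theorem integral_Ico_exp {j : ℤ} (hj : j ≠ 0) :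
    ∫ t in Set.Ico (0 : ℝ) 1, Complex.exp ((2 * Real.pi * (j * t) : ℝ) * Complex.I) = 0 := by
  rw [integral_Ico_eq_integral_Ioc, ← intervalIntegral.integral_of_le zero_le_one]
  have hc : (2 * Real.pi * j * Complex.I : ℂ) ≠ 0 := by
    simp [Real.pi_ne_zero, hj]
  have h := integral_exp_mul_complex (a := 0) (b := 1) hc
  have h1 : Complex.exp (2 * Real.pi * j * Complex.I * (1 : ℝ)) = 1 := by
    rw [← Complex.exp_int_mul_two_pi_mul_I j]
    congr 1
    push_cast
    ring
  rw [h1] at h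
  simp only [Complex.ofReal_zero, mul_zero, Complex.exp_zero, sub_self, zero_div] at h
  rw [← h]
  congr 1 with t
  congr 1
  push_cast
  ring

theorem integral_torusMeasure_exp {m : Fin n → ℤ} (hm : m ≠ 0) :
    ∫ x, Complex.exp ((2 * Real.pi * ⟪intVec m, x⟫ : ℝ) * Complex.I) ∂(torusMeasure n) = 0 := by
  obtain ⟨j, hj⟩ := Function.ne_iff.1 hm
  let f : (i : Fin n) → ℝ → ℂ := fun i t => Complex.exp ((2 * Real.pi * (m i * t) : ℝ) * Complex.I)
  have hf : ∀ x : RSpace n, Complex.exp ((2 * Real.pi * ⟪intVec m, x⟫ : ℝ) * Complex.I) =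
      ∏ i, f i (WithLp.ofLp x i) := by
    intro x
    rw [← Complex.exp_sum, ← Finset.sum_mul, ← Complex.ofReal_sum, ← Finset.mul_sum]
    simp [intVec, PiLp.inner_apply, mul_comm]
  have hs : {x : RSpace n | ∀ i, x i ∈ Set.Ico (0 : ℝ) 1} =
      (WithLp.ofLp : RSpace n → Fin n → ℝ) ⁻¹' Set.univ.pi fun _ => Set.Ico (0 : ℝ) 1 := by
    ext x
    simp
  simp_rw [hf]
  rw [torusMeasure, hs,
    (PiLp.volume_preserving_ofLp (Fin n)).setIntegral_preimage_emb
      (MeasurableEquiv.toLp 2 (Fin n → ℝ)).symm.measurableEmbedding (fun y => ∏ i, f i (y i)),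
    volume_pi, Measure.restrict_pi_pi, integral_fintype_prod_eq_prod]
  exact Finset.prod_eq_zero (Finset.mem_univ j) (integral_Ico_exp hj)

theorem quasiMeasurePreserving_zak (m : Fin n → ℤ) :
    Measure.QuasiMeasurePreserving
      (fun p : (RSpace n × RSpace n) × RSpace n => (intVec m + p.1.1, p.2))
      ((torusMeasure2 n).prod volume) (volume.prod volume) := by
  have h1 : MeasurePreserving (fun q : RSpace n × RSpace n => (intVec m + q.1, q.2))
      (volume.prod volume) (volume.prod volume) :=
    (measurePreserving_add_left volume (intVec m)).prod (MeasurePreserving.id volume)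
  have h2 : MeasurePreserving (Prod.map Prod.fst id)
      ((torusMeasure2 n).prod (volume : Measure (RSpace n))) ((torusMeasure n).prod volume) :=
    measurePreserving_fst.prod (MeasurePreserving.id volume)
  have h3 : (torusMeasure n).prod (volume : Measure (RSpace n)) ≪ volume.prod volume :=
    Measure.AbsolutelyContinuous.prod Measure.restrict_le_self.absolutelyContinuous
      Measure.AbsolutelyContinuous.rfl
  exact (h1.quasiMeasurePreserving.mono_left h3).comp h2.quasiMeasurePreserving

theorem coeFn_zakTerm (m : Fin n → ℤ) (K : L2R2 n) :
    zakTerm m K =ᵐ[(torusMeasure2 n).prod volume] fun p =>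
      Complex.exp ((-2 * Real.pi * ⟪intVec m, p.1.2⟫ : ℝ) * Complex.I) *
        K (intVec m + p.1.1, p.2) :=
  (memLp_zakTerm m K).coeFn_toLp

theorem zakTerm_add (m : Fin n → ℤ) (K L : L2R2 n) :
    zakTerm m (K + L) = zakTerm m K + zakTerm m L := by
  rw [zakTerm, zakTerm, zakTerm, ← MemLp.toLp_add, MemLp.toLp_eq_toLp_iff]
  filter_upwards [(quasiMeasurePreserving_zak m).ae (Lp.coeFn_add K L)] with p h
  rw [h, Pi.add_apply, Pi.add_apply, mul_add]

theorem zakTerm_smul (m : Fin n → ℤ) (c : ℂ) (K : L2R2 n) :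
    zakTerm m (c • K) = c • zakTerm m K := by
  rw [zakTerm, zakTerm, ← MemLp.toLp_const_smul, MemLp.toLp_eq_toLp_iff]
  filter_upwards [(quasiMeasurePreserving_zak m).ae (Lp.coeFn_smul c K)] with p h
  rw [h, Pi.smul_apply, Pi.smul_apply, smul_eq_mul, smul_eq_mul]
  ring

/-- The terms of the Zak series are pairwise orthogonal, as the characters of `𝕋ⁿ` in the
variable `ξ'` are. -/
theorem inner_zakTerm_eq_zero {m m' : Fin n → ℤ} (hm : m ≠ m') (K L : L2R2 n) :
    inner ℂ (zakTerm m K) (zakTerm m' L) = 0 := by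
  let F : RSpace n → RSpace n → ℂ := fun ξ η =>
    L (intVec m' + ξ, η) * (starRingEnd ℂ) (K (intVec m + ξ, η))
  have hF : (fun p => inner ℂ (zakTerm m K p) (zakTerm m' L p))
      =ᵐ[(torusMeasure2 n).prod volume] fun p =>
        Complex.exp ((2 * Real.pi * ⟪intVec (m - m'), p.1.2⟫ : ℝ) * Complex.I) * F p.1.1 p.2 := by
    filter_upwards [coeFn_zakTerm m K, coeFn_zakTerm m' L] with p h1 h2
    rw [h1, h2, RCLike.inner_apply, map_mul, ← Complex.exp_conj, map_mul, Complex.conj_I,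
      Complex.conj_ofReal, mul_mul_mul_comm, ← Complex.exp_add, intVec_sub, inner_sub_left]
    congr 2
    push_cast
    ring
  have hint := (L2.integrable_inner (𝕜 := ℂ) (zakTerm m K) (zakTerm m' L)).congr hF
  rw [L2.inner_def, integral_congr_ae hF, integral_prod _ hint]
  simp_rw [integral_const_mul]
  have h := integral_prod_mul (μ := torusMeasure n) (ν := torusMeasure n) (fun ξ => ∫ η, F ξ η)
    (fun ξ' => Complex.exp ((2 * Real.pi * ⟪intVec (m - m'), ξ'⟫ : ℝ) * Complex.I))
  rw [integral_torusMeasure_exp (sub_ne_zero.2 hm), mul_zero] at h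
  rw [torusMeasure2, ← h]
  congr 1 with p
  rw [mul_comm]

/-- The unit cell `(m + [0,1)ⁿ) × ℝⁿ`. -/
def cell (m : Fin n → ℤ) : Set (RSpace n × RSpace n) :=
  {p | ∀ i, p.1 i - m i ∈ Set.Ico (0 : ℝ) 1}

theorem mem_cell_iff (m : Fin n → ℤ) (p : RSpace n × RSpace n) :
    p ∈ cell m ↔ m = fun i => ⌊p.1 i⌋ := by
  rw [funext_iff]
  refine forall_congr' fun i => ?_
  rw [eq_comm, Int.floor_eq_iff, Set.mem_Ico, sub_nonneg, sub_lt_iff_lt_add']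

theorem measurableSet_cell (m : Fin n → ℤ) : MeasurableSet (cell m) := by
  rw [cell, Set.ofPred_forall]
  exact MeasurableSet.iInter fun i => measurableSet_Ico.preimage (by fun_prop)

theorem enorm_zakTerm_sq (m : Fin n → ℤ) (K : L2R2 n) :
    ‖zakTerm m K‖ₑ ^ 2 = ∫⁻ p in cell m, ‖K p‖ₑ ^ 2 ∂(volume.prod volume) := by
  have hK : Measurable fun p : RSpace n × RSpace n => ‖K p‖ₑ ^ 2 :=
    (Lp.stronglyMeasurable K).measurable.enorm.pow_const 2
  have h1 : MeasurePreserving (fun q : RSpace n × RSpace n => (intVec m + q.1, q.2))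
      (volume.prod volume) (volume.prod volume) :=
    (measurePreserving_add_left volume (intVec m)).prod (MeasurePreserving.id volume)
  have h2 : MeasurePreserving (Prod.map Prod.fst id)
      ((torusMeasure2 n).prod (volume : Measure (RSpace n))) ((torusMeasure n).prod volume) :=
    measurePreserving_fst.prod (MeasurePreserving.id volume)
  have h3 : (torusMeasure n).prod (volume : Measure (RSpace n)) = (volume.prod volume).restrict
      ({x : RSpace n | ∀ i, x i ∈ Set.Ico (0 : ℝ) 1} ×ˢ Set.univ) := by
    rw [← Measure.prod_restrict, Measure.restrict_univ, torusMeasure]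
  have h4 : (fun q : RSpace n × RSpace n => (intVec m + q.1, q.2)) ⁻¹' cell m =
      {x : RSpace n | ∀ i, x i ∈ Set.Ico (0 : ℝ) 1} ×ˢ Set.univ := by
    ext q
    simp [cell, intVec]
  have h5 := h2.lintegral_comp (f := fun q : RSpace n × RSpace n => ‖K (intVec m + q.1, q.2)‖ₑ ^ 2)
    (hK.comp h1.measurable)
  rw [Lp.enorm_def, eLpNorm_two_sq, ← h1.setLIntegral_comp_preimage (measurableSet_cell m) hK, h4,
    ← h3, ← h5]
  refine lintegral_congr_ae ?_
  filter_upwards [coeFn_zakTerm m K] with p hp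
  rw [hp, enorm_mul, ← ofReal_norm, Complex.norm_exp_ofReal_mul_I]
  simp

theorem tsum_enorm_zakTerm_sq (K : L2R2 n) : ∑' m, ‖zakTerm m K‖ₑ ^ 2 = ‖K‖ₑ ^ 2 := by
  have hU : ⋃ m : Fin n → ℤ, cell m = (Set.univ : Set (RSpace n × RSpace n)) := by
    ext p
    simp [mem_cell_iff]
  have hd : Pairwise (Function.onFun Disjoint (cell (n := n))) := by
    intro m m' h
    refine Set.disjoint_left.2 fun p h1 h2 => h ?_
    rw [mem_cell_iff] at h1 h2
    rw [h1, h2]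
  simp_rw [enorm_zakTerm_sq]
  rw [← lintegral_iUnion measurableSet_cell hd, hU, Measure.restrict_univ, Lp.enorm_def,
    eLpNorm_two_sq]

theorem hasSum_norm_zakTerm_sq (K : L2R2 n) :
    HasSum (fun m : Fin n → ℤ => ‖zakTerm m K‖ ^ 2) (‖K‖ ^ 2) := by
  have h := tsum_enorm_zakTerm_sq K
  have h1 : ∀ m : Fin n → ℤ, ‖zakTerm m K‖ ^ 2 = (‖zakTerm m K‖ₑ ^ 2).toReal := by
    intro m
    simp
  have h2 : ‖K‖ ^ 2 = (‖K‖ₑ ^ 2).toReal := by simp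
  simp_rw [h1, h2, ← h]
  rw [ENNReal.tsum_toReal_eq fun m => by simp]
  refine ENNReal.hasSum_toReal ?_
  rw [h]
  simp

/-- Pythagoras' theorem for a series of pairwise orthogonal vectors. -/
theorem hasSum_of_orthogonal {ι H : Type*} [NormedAddCommGroup H] [InnerProductSpace ℂ H]
    [CompleteSpace H] {z : ι → H} (hz : ∀ i j, i ≠ j → inner ℂ (z i) (z j) = 0) {C : ℝ}
    (hC : HasSum (fun i => ‖z i‖ ^ 2) C) : Summable z ∧ ‖∑' i, z i‖ ^ 2 = C := by
  have hO : OrthogonalFamily ℂ (fun i => ↥(ℂ ∙ z i)) fun i => (ℂ ∙ z i).subtypeₗᵢ := by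
    refine OrthogonalFamily.of_pairwise fun i j hij => ?_
    change (ℂ ∙ z i) ⟂ (ℂ ∙ z j)
    rw [Submodule.isOrtho_span]
    intro u hu v hv
    rw [Set.mem_singleton_iff.1 hu, Set.mem_singleton_iff.1 hv]
    exact hz i j hij
  let w : ∀ i, ↥(ℂ ∙ z i) := fun i => ⟨z i, Submodule.mem_span_singleton_self _⟩
  have hs : Summable z := (hO.summable_iff_norm_sq_summable w).2 hC.summable
  refine ⟨hs, ?_⟩
  have h1 : HasSum (fun i => ‖z i‖ ^ 2) (‖∑' i, z i‖ ^ 2) := by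
    refine ((hs.hasSum.norm.pow 2).congr fun s => ?_)
    exact hO.norm_sum w s
  exact h1.unique hC

theorem summable_zakTerm (K : L2R2 n) : Summable fun m : Fin n → ℤ => zakTerm m K :=
  (hasSum_of_orthogonal (fun _ _ h => inner_zakTerm_eq_zero h K K) (hasSum_norm_zakTerm_sq K)).1

theorem weylZak_add (f g : L2R2 n) : weylZak (f + g) = weylZak f + weylZak g := by
  have h : weylKernel (f + g) = weylKernel f + weylKernel g := (weylKernelIsometry n).map_add f g
  simp only [weylZak, h, zakTerm_add]
  exact (summable_zakTerm _).tsum_add (summable_zakTerm _)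

theorem weylZak_smul (c : ℂ) (f : L2R2 n) : weylZak (c • f) = c • weylZak f := by
  have h : weylKernel (c • f) = c • weylKernel f := (weylKernelIsometry n).map_smul c f
  simp only [weylZak, h, zakTerm_smul]
  exact (summable_zakTerm _).tsum_const_smul c

theorem norm_weylZak (f : L2R2 n) : ‖weylZak f‖ = ‖f‖ := by
  have h : ‖weylKernel f‖ = ‖f‖ := (weylKernelIsometry n).norm_map f
  rw [← h, ← sq_eq_sq₀ (norm_nonneg _) (norm_nonneg _)]
  exact (hasSum_of_orthogonal (fun _ _ h => inner_zakTerm_eq_zero h _ _)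
    (hasSum_norm_zakTerm_sq (weylKernel f))).2

variable (n) in
/-- The transform `𝒥` as a linear isometry. -/
def calJIsometry : L2R2 n →ₗᵢ[ℂ] Lp (L2R n) 2 (torusMeasure2 n) where
  toFun := calJ
  map_add' f g := by simp only [calJ, weylZak_add, map_add]
  map_smul' c f := by simp only [calJ, weylZak_smul, map_smul, RingHom.id_apply]
  norm_map' f := ((lpCurry (torusMeasure2 n) volume).norm_map (weylZak f)).trans (norm_weylZak f)

theorem calJIsometry_apply (f : L2R2 n) : calJIsometry n f = calJ f := rfl

/-- The phase `2π(k·ξ + l·ξ')` of the character of `𝕋ⁿ × 𝕋ⁿ` with frequency `(k, l)`. -/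
def charPhase (k l : Fin n → ℤ) (ω : RSpace n × RSpace n) : ℝ :=
  2 * Real.pi * ⟪intVec k, ω.1⟫ + 2 * Real.pi * ⟪intVec l, ω.2⟫

theorem measurable_charPhase (k l : Fin n → ℤ) : Measurable (charPhase k l) := by
  unfold charPhase
  fun_prop

theorem lpCurry_phaseMul_fst (θ : RSpace n × RSpace n → ℝ) (hθ : Measurable θ)
    (w : Lp ℂ 2 ((torusMeasure2 n).prod (volume : Measure (RSpace n)))) :
    lpCurry (torusMeasure2 n) volume (phaseMul (fun p => θ p.1) (by fun_prop) w) =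
      phaseMul θ hθ (lpCurry (torusMeasure2 n) volume w) := by
  refine Lp.ext ?_
  filter_upwards [coeFn_phaseMul θ hθ (lpCurry (torusMeasure2 n) volume w), lpCurry_coeFn w,
    lpCurry_coeFn (phaseMul (fun p : (RSpace n × RSpace n) × RSpace n => θ p.1) (by fun_prop) w),
    Measure.ae_ae_of_ae_prod
      (coeFn_phaseMul (fun p : (RSpace n × RSpace n) × RSpace n => θ p.1) (by fun_prop) w)]
    with x h1 h2 h3 h4
  rw [h1]
  refine Lp.ext ?_
  filter_upwards [h2, h3, h4, Lp.coeFn_smul (Complex.exp (θ x * Complex.I))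
    (lpCurry (torusMeasure2 n) volume w x)] with y y2 y3 y4 y5
  rw [y5, y3, y4, Pi.smul_apply, y2]

/-- The phases of the Zak transform combine to a character, because `e^{2πi k·m} = 1`. -/
theorem exp_zakPhase (k l m : Fin n → ℤ) (ω : RSpace n × RSpace n) :
    Complex.exp ((-2 * Real.pi * ⟪intVec m, ω.2⟫ : ℝ) * Complex.I) *
        Complex.exp ((Real.pi * ⟪intVec k, intVec l⟫ +
          2 * Real.pi * ⟪intVec k, intVec m + ω.1⟫ : ℝ) * Complex.I) =
      Complex.exp ((Real.pi * ⟪intVec k, intVec l⟫ : ℝ) * Complex.I) *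
        (Complex.exp (charPhase k l ω * Complex.I) *
          Complex.exp ((-2 * Real.pi * ⟪intVec (m + l), ω.2⟫ : ℝ) * Complex.I)) := by
  rw [← Complex.exp_add, ← Complex.exp_add, ← Complex.exp_add]
  -- the two exponents differ by `2πi k·m`
  refine Complex.exp_eq_exp_iff_exists_int.2 ⟨∑ i, k i * m i, ?_⟩
  have h : ((∑ i, k i * m i : ℤ) : ℂ) = ((⟪intVec k, intVec m⟫ : ℝ) : ℂ) := by
    rw [inner_intVec, Complex.ofReal_intCast]
  rw [h, intVec_add, inner_add_left, inner_add_right, charPhase]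
  push_cast
  ring

theorem measurable_charPhase_fst (k l : Fin n → ℤ) :
    Measurable fun p : (RSpace n × RSpace n) × RSpace n => charPhase k l p.1 :=
  (measurable_charPhase k l).comp measurable_fst

/-- A twisted translation shifts the index of the Zak series by `l`. -/
theorem zakTerm_weylKernel_twistedTranslation (k l m : Fin n → ℤ) (f : L2R2 n) (c : ℂ)
    (hc : c = Complex.exp ((Real.pi * ⟪intVec k, intVec l⟫ : ℝ) * Complex.I)) :
    zakTerm m (weylKernel (twistedTranslation k l f)) =
      c • phaseMul _ (measurable_charPhase_fst k l) (zakTerm (m + l) (weylKernel f)) := by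
  refine Lp.ext ?_
  filter_upwards [(quasiMeasurePreserving_zak m).ae (weylKernel_twistedTranslation k l f),
    coeFn_zakTerm m (weylKernel (twistedTranslation k l f)),
    coeFn_zakTerm (m + l) (weylKernel f),
    Lp.coeFn_smul c (phaseMul _ (measurable_charPhase_fst k l) (zakTerm (m + l) (weylKernel f))),
    coeFn_phaseMul _ (measurable_charPhase_fst k l) (zakTerm (m + l) (weylKernel f))]
    with p hK h1 h2 h4 h5
  have hv : intVec l + (intVec m + p.1.1) = intVec (m + l) + p.1.1 := by
    rw [intVec_add]
    abel
  rw [h1, hK, h4, Pi.smul_apply, h5, h2, smul_eq_mul, smul_eq_mul, hv, ← mul_assoc,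
    exp_zakPhase, hc, mul_assoc, mul_assoc]

/-- Multiplication by the character with frequency `(k, l)` on `L²(𝕋ⁿ × 𝕋ⁿ × ℝⁿ)`. -/
def zakCharMul (k l : Fin n → ℤ) :
    Lp ℂ 2 ((torusMeasure2 n).prod (volume : Measure (RSpace n))) →L[ℂ]
      Lp ℂ 2 ((torusMeasure2 n).prod (volume : Measure (RSpace n))) :=
  (phaseMul _ (measurable_charPhase_fst k l)).toContinuousLinearMap

theorem weylZak_twistedTranslation (k l : Fin n → ℤ) (f : L2R2 n) (c : ℂ)
    (hc : c = Complex.exp ((Real.pi * ⟪intVec k, intVec l⟫ : ℝ) * Complex.I)) :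
    weylZak (twistedTranslation k l f) = c • zakCharMul k l (weylZak f) := by
  have hs : Summable fun m => zakTerm (m + l) (weylKernel f) :=
    (Equiv.addRight l).summable_iff (f := fun m => zakTerm m (weylKernel f)) |>.2
      (summable_zakTerm (weylKernel f))
  have h1 : (fun m => zakTerm m (weylKernel (twistedTranslation k l f))) = fun m =>
      (c • zakCharMul k l) (zakTerm (m + l) (weylKernel f)) :=
    funext fun m => zakTerm_weylKernel_twistedTranslation k l m f c hc
  have h2 : weylZak f = ∑' m, zakTerm (m + l) (weylKernel f) :=
    ((Equiv.addRight l).tsum_eq fun m => zakTerm m (weylKernel f)).symm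
  rw [weylZak, h1, h2]
  exact ((c • zakCharMul k l).map_tsum hs).symm

/-- `𝒥` turns the twisted translation `T^t_{(k,l)}` into multiplication by the character with
frequency `(k, l)`, up to a constant factor of modulus one. -/
theorem calJ_twistedTranslation (k l : Fin n → ℤ) (f : L2R2 n) :
    calJ (twistedTranslation k l f) =
      Complex.exp ((Real.pi * ⟪intVec k, intVec l⟫ : ℝ) * Complex.I) •
        phaseMul (charPhase k l) (measurable_charPhase k l) (calJ f) := by
  rw [calJ, calJ, ← lpCurry_phaseMul_fst, ← map_smul,
    weylZak_twistedTranslation k l f _ rfl]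
  rfl

end Zak

/-! ### Uniqueness of Fourier coefficients on `𝕋ⁿ × 𝕋ⁿ` -/

section Uniqueness

variable {n : ℕ}

/-- An integrable function on a compact metric space that annihilates all continuous functions
vanishes almost everywhere: the indicators of closed sets are bounded pointwise limits of continuous
functions. -/
theorem ae_eq_zero_of_forall_integral_continuous_mul_eq_zero {X : Type*} [PseudoMetricSpace X]
    [CompactSpace X] [MeasurableSpace X] [BorelSpace X] {ν : Measure X} {ψ : X → ℂ}
    (hψ : Integrable ψ ν) (h : ∀ c : C(X, ℂ), ∫ x, c x * ψ x ∂ν = 0) : ψ =ᵐ[ν] 0 := by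
  refine ae_eq_zero_of_forall_setIntegral_isClosed_eq_zero hψ fun s hs => ?_
  have hδ : ∀ j : ℕ, 0 < (1 : ℝ) / (j + 1) := fun j => Nat.one_div_pos_of_nat
  let c : ℕ → X → ℂ := fun j x => ((thickenedIndicator (hδ j) s x : ℝ) : ℂ)
  have hc : ∀ j, Continuous (c j) := fun j => by fun_prop
  have h0 : ∀ j, ∫ x, c j x * ψ x ∂ν = 0 := fun j => h ⟨c j, hc j⟩
  have hlim : Tendsto (fun j => ∫ x, c j x * ψ x ∂ν) atTop (𝓝 (∫ x, s.indicator ψ x ∂ν)) := by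
    refine tendsto_integral_of_dominated_convergence (fun x => ‖ψ x‖)
      (fun j => (hc j).aestronglyMeasurable.mul hψ.1) hψ.norm (fun j => ?_) ?_
    · refine Eventually.of_forall fun x => ?_
      rw [norm_mul]
      refine mul_le_of_le_one_left (norm_nonneg _) ?_
      simp only [c, Complex.norm_real, NNReal.norm_eq]
      exact_mod_cast thickenedIndicator_le_one (hδ j) s x
    · refine Eventually.of_forall fun x => ?_
      have h1 := tendsto_pi_nhds.1
        (thickenedIndicator_tendsto_indicator_closure hδ
          tendsto_one_div_add_atTop_nhds_zero_nat s) x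
      rw [hs.closure_eq] at h1
      have h2 : Tendsto (fun j => c j x) atTop
          (𝓝 (((s.indicator (fun _ => (1 : NNReal)) x : NNReal) : ℝ) : ℂ)) :=
        (Complex.continuous_ofReal.tendsto _).comp ((NNReal.continuous_coe.tendsto _).comp h1)
      convert h2.mul_const (ψ x) using 2
      by_cases hx : x ∈ s <;> simp [hx]
  simp_rw [h0] at hlim
  rw [← integral_indicator hs.measurableSet]
  exact (tendsto_nhds_unique hlim tendsto_const_nhds)

/-- The projection `ℝⁿ × ℝⁿ → (ℝ/ℤ)²ⁿ`. -/
def torusProj (ω : RSpace n × RSpace n) : UnitAddTorus (Fin n ⊕ Fin n) :=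
  Sum.elim (fun i => (ω.1 i : UnitAddCircle)) fun i => (ω.2 i : UnitAddCircle)

/-- The section of `torusProj` with values in `[0,1)ⁿ × [0,1)ⁿ`. -/
def torusSection (z : UnitAddTorus (Fin n ⊕ Fin n)) : RSpace n × RSpace n :=
  (WithLp.toLp 2 fun i => (AddCircle.measurableEquivIco 1 0 (z (Sum.inl i)) : ℝ),
    WithLp.toLp 2 fun i => (AddCircle.measurableEquivIco 1 0 (z (Sum.inr i)) : ℝ))

theorem measurable_torusProj : Measurable (torusProj (n := n)) := by
  refine measurable_pi_lambda _ fun i => ?_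
  cases i
  · exact (AddCircle.continuous_mk' 1).measurable.comp (by fun_prop)
  · exact (AddCircle.continuous_mk' 1).measurable.comp (by fun_prop)

theorem measurable_torusSection : Measurable (torusSection (n := n)) := by
  unfold torusSection
  fun_prop

theorem ae_mem_cube (n : ℕ) : ∀ᵐ x ∂(torusMeasure n), ∀ i, x i ∈ Set.Ico (0 : ℝ) 1 :=
  ae_restrict_mem (measurableSet_cube n)

theorem torusSection_torusProj :
    ∀ᵐ ω ∂(torusMeasure2 n), torusSection (torusProj ω) = ω := by
  have key : ∀ x ∈ Set.Ico (0 : ℝ) 1,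
      (AddCircle.measurableEquivIco 1 0 (x : UnitAddCircle) : ℝ) = x := by
    intro x hx
    have hx' : x ∈ Set.Ico (0 : ℝ) (0 + 1) := by simpa using hx
    exact congrArg Subtype.val (AddCircle.equivIco_coe_eq hx')
  have h1 : ∀ᵐ ω ∂(torusMeasure2 n), ∀ i, ω.1 i ∈ Set.Ico (0 : ℝ) 1 :=
    Measure.quasiMeasurePreserving_fst.ae (ae_mem_cube n)
  have h2 : ∀ᵐ ω ∂(torusMeasure2 n), ∀ i, ω.2 i ∈ Set.Ico (0 : ℝ) 1 :=
    Measure.quasiMeasurePreserving_snd.ae (ae_mem_cube n)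
  filter_upwards [h1, h2] with ω h1 h2
  refine Prod.ext ?_ ?_
  · ext i
    exact key _ (h1 i)
  · ext i
    exact key _ (h2 i)

theorem mFourier_torusProj (m : Fin n ⊕ Fin n → ℤ) (ω : RSpace n × RSpace n) :
    UnitAddTorus.mFourier m (torusProj ω) =
      Complex.exp (charPhase (fun i => m (Sum.inl i)) (fun i => m (Sum.inr i)) ω * Complex.I) := by
  have h : (charPhase (fun i => m (Sum.inl i)) (fun i => m (Sum.inr i)) ω : ℂ) * Complex.I =
      ∑ i, 2 * Real.pi * Complex.I * m (Sum.inl i) * ω.1 i +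
        ∑ i, 2 * Real.pi * Complex.I * m (Sum.inr i) * ω.2 i := by
    simp only [charPhase, intVec, PiLp.inner_apply, RCLike.inner_apply, conj_trivial]
    push_cast
    rw [Finset.mul_sum, Finset.mul_sum, add_mul, Finset.sum_mul, Finset.sum_mul]
    congr 1 <;> refine Finset.sum_congr rfl fun i _ => by ring
  rw [h, Complex.exp_add, Complex.exp_sum, Complex.exp_sum]
  simp only [UnitAddTorus.mFourier, ContinuousMap.coe_mk, Fintype.prod_sum_type, torusProj,
    Sum.elim_inl, Sum.elim_inr, fourier_coe_apply, Complex.ofReal_one, div_one]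

/-- An integrable function on `𝕋ⁿ × 𝕋ⁿ` all of whose Fourier coefficients vanish is zero almost
everywhere. -/
theorem ae_eq_zero_of_forall_integral_char_mul_eq_zero {φ : RSpace n × RSpace n → ℂ}
    (hφ : Integrable φ (torusMeasure2 n))
    (h : ∀ k l : Fin n → ℤ,
      ∫ ω, Complex.exp (charPhase k l ω * Complex.I) * φ ω ∂(torusMeasure2 n) = 0) :
    φ =ᵐ[torusMeasure2 n] 0 := by
  let ν : Measure (UnitAddTorus (Fin n ⊕ Fin n)) := (torusMeasure2 n).map torusProj
  have hπ : MeasurePreserving torusProj (torusMeasure2 n) ν :=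
    measurable_torusProj.measurePreserving _
  have hσ : MeasurePreserving torusSection ν (torusMeasure2 n) := by
    refine ⟨measurable_torusSection, ?_⟩
    rw [Measure.map_map measurable_torusSection measurable_torusProj]
    exact (Measure.map_congr torusSection_torusProj).trans Measure.map_id
  have hψ : Integrable (φ ∘ torusSection) ν := hσ.integrable_comp_of_integrable hφ
  -- pairing with `φ ∘ torusSection` is a continuous functional on `C((ℝ/ℤ)²ⁿ)`
  have hint : ∀ c : C(UnitAddTorus (Fin n ⊕ Fin n), ℂ),
      Integrable (fun z => c z * (φ ∘ torusSection) z) ν := fun c =>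
    hψ.bdd_mul c.continuous.aestronglyMeasurable
      (Eventually.of_forall fun z => c.norm_coe_le_norm z)
  let T : C(UnitAddTorus (Fin n ⊕ Fin n), ℂ) →L[ℂ] ℂ :=
    LinearMap.mkContinuous
      { toFun := fun c => ∫ z, c z * (φ ∘ torusSection) z ∂ν
        map_add' := fun c d => by
          rw [← integral_add (hint c) (hint d)]
          simp only [ContinuousMap.add_apply, add_mul]
        map_smul' := fun r c => by
          rw [RingHom.id_apply, smul_eq_mul, ← integral_const_mul]
          simp only [ContinuousMap.smul_apply, smul_eq_mul, mul_assoc] }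
      (∫ z, ‖(φ ∘ torusSection) z‖ ∂ν) fun c => by
        refine (norm_integral_le_integral_norm _).trans ?_
        rw [mul_comm, ← integral_const_mul]
        refine integral_mono (hint c).norm (hψ.norm.const_mul _) fun z => ?_
        simp only [norm_mul]
        exact mul_le_mul_of_nonneg_right (c.norm_coe_le_norm z) (norm_nonneg _)
  have hT : ∀ c, T c = 0 := by
    have h1 : (Submodule.span ℂ (Set.range
        (UnitAddTorus.mFourier (d := Fin n ⊕ Fin n)))).topologicalClosure ≤
          LinearMap.ker T.toLinearMap := by
      refine Submodule.topologicalClosure_minimal _ ?_ T.isClosed_ker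
      rw [Submodule.span_le]
      rintro _ ⟨m, rfl⟩
      change ∫ z, UnitAddTorus.mFourier m z * (φ ∘ torusSection) z ∂ν = 0
      rw [integral_map measurable_torusProj.aemeasurable (hint _).1,
        ← h (fun i => m (Sum.inl i)) fun i => m (Sum.inr i)]
      refine integral_congr_ae ?_
      filter_upwards [torusSection_torusProj] with ω hω
      rw [mFourier_torusProj, Function.comp_apply, hω]
    intro c
    rw [UnitAddTorus.span_mFourier_closure_eq_top] at h1
    exact h1 (Submodule.mem_top (x := c))
  -- transport back along `torusProj`, of which `torusSection` is a left inverse almost everywhere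
  have h0 := hπ.quasiMeasurePreserving.ae
    (ae_eq_zero_of_forall_integral_continuous_mul_eq_zero hψ hT)
  filter_upwards [h0, torusSection_torusProj] with ω h1 h2
  rw [Function.comp_apply, h2] at h1
  exact h1

end Uniqueness

/-! ### Surjectivity of `𝒥` -/

section Surjective

variable {n : ℕ}

instance isProbabilityMeasure_torusMeasure2 (n : ℕ) : IsProbabilityMeasure (torusMeasure2 n) := by
  unfold torusMeasure2
  infer_instance

/-- Multiplication by the character with frequency `(k, l)` on `L²(𝕋ⁿ × 𝕋ⁿ; L²(ℝⁿ))`. -/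
def charMul (k l : Fin n → ℤ) :
    Lp (L2R n) 2 (torusMeasure2 n) →ₗᵢ[ℂ] Lp (L2R n) 2 (torusMeasure2 n) :=
  phaseMul (charPhase k l) (measurable_charPhase k l)

theorem inner_charMul (k l : Fin n → ℤ) (F G : Lp (L2R n) 2 (torusMeasure2 n)) :
    inner ℂ F (charMul k l G) = ∫ ω, Complex.exp (charPhase k l ω * Complex.I) *
      inner ℂ (F ω) (G ω) ∂(torusMeasure2 n) := by
  rw [L2.inner_def]
  refine integral_congr_ae ?_
  filter_upwards [coeFn_phaseMul (charPhase k l) (measurable_charPhase k l) G] with ω h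
  rw [charMul, h, inner_smul_right]

/-- If `⟨F, G⟩` and `⟨F', G'⟩` have the same Fourier coefficients, they agree almost everywhere. -/
theorem ae_inner_eq_of_forall_inner_charMul {F G F' G' : Lp (L2R n) 2 (torusMeasure2 n)}
    (h : ∀ k l, inner ℂ F (charMul k l G) = inner ℂ F' (charMul k l G')) :
    ∀ᵐ ω ∂(torusMeasure2 n), inner ℂ (F ω) (G ω) = inner ℂ (F' ω) (G' ω) := by
  have hFG := L2.integrable_inner (𝕜 := ℂ) F G
  have hFG' := L2.integrable_inner (𝕜 := ℂ) F' G'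
  have hb : ∀ k l : Fin n → ℤ, ∀ ψ : RSpace n × RSpace n → ℂ, Integrable ψ (torusMeasure2 n) →
      Integrable (fun ω => Complex.exp (charPhase k l ω * Complex.I) * ψ ω) (torusMeasure2 n) := by
    intro k l ψ hψ
    refine hψ.bdd_mul (c := 1) ?_ (Eventually.of_forall fun ω => ?_)
    · exact (Complex.measurable_exp.comp ((Complex.measurable_ofReal.comp
        (measurable_charPhase k l)).mul_const _)).aestronglyMeasurable
    · rw [Complex.norm_exp_ofReal_mul_I]
  have h0 := ae_eq_zero_of_forall_integral_char_mul_eq_zero (hFG.sub hFG') fun k l => by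
    have := h k l
    rw [inner_charMul, inner_charMul, ← sub_eq_zero,
      ← integral_sub (hb k l _ hFG) (hb k l _ hFG')] at this
    simpa only [mul_sub, Pi.sub_apply] using this
  filter_upwards [h0] with ω hω
  exact sub_eq_zero.1 hω

theorem ae_inner_eq_zero_of_forall_inner_charMul {F G : Lp (L2R n) 2 (torusMeasure2 n)}
    (h : ∀ k l, inner ℂ F (charMul k l G) = 0) :
    ∀ᵐ ω ∂(torusMeasure2 n), inner ℂ (F ω) (G ω) = 0 := by
  have h1 := ae_inner_eq_of_forall_inner_charMul (F := F) (G := G) (F' := 0) (G' := G)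
    fun k l => by rw [h k l, inner_zero_left]
  filter_upwards [h1, Lp.coeFn_zero (L2R n) 2 (torusMeasure2 n)] with ω h1 h2
  rw [h1, h2, Pi.zero_apply, inner_zero_left]

theorem quasiMeasurePreserving_intVec_add_fst (m : Fin n → ℤ) :
    Measure.QuasiMeasurePreserving (fun ω : RSpace n × RSpace n => intVec m + ω.1)
      (torusMeasure2 n) volume :=
  ((measurePreserving_add_left volume (intVec m)).quasiMeasurePreserving.mono_left
    Measure.restrict_le_self.absolutelyContinuous).comp
      (Measure.quasiMeasurePreserving_fst (μ := torusMeasure n) (ν := torusMeasure n))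

theorem lpCurry_zakTerm (m : Fin n → ℤ) (K : L2R2 n) :
    ∀ᵐ ω ∂(torusMeasure2 n), lpCurry (torusMeasure2 n) volume (zakTerm m K) ω =
      Complex.exp ((-2 * Real.pi * ⟪intVec m, ω.2⟫ : ℝ) * Complex.I) •
        lpCurry volume volume K (intVec m + ω.1) := by
  filter_upwards [lpCurry_coeFn (zakTerm m K), Measure.ae_ae_of_ae_prod (coeFn_zakTerm m K),
    (quasiMeasurePreserving_intVec_add_fst m).ae (lpCurry_coeFn K)] with ω h1 h2 h3
  refine Lp.ext ?_
  filter_upwards [h1, h2, h3, Lp.coeFn_smul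
    (Complex.exp ((-2 * Real.pi * ⟪intVec m, ω.2⟫ : ℝ) * Complex.I))
    (lpCurry volume volume K (intVec m + ω.1))] with η e1 e2 e3 e4
  rw [e1, e2, e4, Pi.smul_apply, e3, smul_eq_mul]

theorem volume_cube_ne_top (n : ℕ) :
    volume {x : RSpace n | ∀ i, x i ∈ Set.Ico (0 : ℝ) 1} ≠ ∞ := by
  have h := measure_ne_top (torusMeasure n) Set.univ
  rwa [torusMeasure, Measure.restrict_apply_univ] at h

/-- Constant functions lie in the range of `𝒥`: they come from the kernels
`1_{[0,1)ⁿ}(ξ) a(η)`. -/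
theorem exists_calJ_eq_const (a : L2R n) :
    ∃ f : L2R2 n, ∀ᵐ ω ∂(torusMeasure2 n), calJ f ω = a := by
  obtain ⟨f, hf⟩ := weylKernel_surjective ((lpCurry volume volume).symm
    (indicatorConstLp 2 (measurableSet_cube n) (volume_cube_ne_top n) a))
  have hK : lpCurry volume volume (weylKernel f) =ᵐ[volume]
      {x : RSpace n | ∀ i, x i ∈ Set.Ico (0 : ℝ) 1}.indicator fun _ => a := by
    rw [hf, LinearIsometryEquiv.apply_symm_apply]
    exact indicatorConstLp_coeFn
  have h1 : ∀ᵐ ω ∂(torusMeasure2 n), ∀ i, ω.1 i ∈ Set.Ico (0 : ℝ) 1 :=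
    Measure.quasiMeasurePreserving_fst.ae (ae_mem_cube n)
  have h0 : ∀ m : Fin n → ℤ, m ≠ 0 → zakTerm m (weylKernel f) = 0 := by
    intro m hm
    rw [← (lpCurry (torusMeasure2 n) volume).map_eq_zero_iff]
    refine Lp.ext ?_
    filter_upwards [lpCurry_zakTerm m (weylKernel f),
      (quasiMeasurePreserving_intVec_add_fst m).ae hK, h1,
      Lp.coeFn_zero (L2R n) 2 (torusMeasure2 n)] with ω e1 e2 e3 e4
    rw [e1, e2, e4, Set.indicator_of_notMem, smul_zero, Pi.zero_apply]
    intro hmem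
    refine hm (funext fun i => ?_)
    -- both `ω.1 i` and `m i + ω.1 i` lie in `[0,1)`, so the integer `m i` vanishes
    have h2 : (m i : ℝ) + ω.1 i ∈ Set.Ico (0 : ℝ) 1 := hmem i
    have h3 : (m i : ℝ) < 1 := by linarith [h2.2, (e3 i).1]
    have h4 : (-1 : ℝ) < m i := by linarith [h2.1, (e3 i).2]
    have h5 : m i < 1 := by exact_mod_cast h3
    have h6 : -1 < m i := by exact_mod_cast h4
    simp only [Pi.zero_apply]
    omega
  refine ⟨f, ?_⟩
  rw [calJ, weylZak, tsum_eq_single 0 h0]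
  filter_upwards [lpCurry_zakTerm 0 (weylKernel f),
    (quasiMeasurePreserving_intVec_add_fst 0).ae hK, h1] with ω e1 e2 e3
  have hz : intVec (0 : Fin n → ℤ) = 0 := by
    ext i
    simp [intVec]
  rw [e1, e2, Set.indicator_of_mem]
  · simp [hz]
  · intro i
    simpa [hz] using e3 i

theorem exists_charMul_calJ (k l : Fin n → ℤ) :
    ∃ c : ℂ, ∀ f : L2R2 n, charMul k l (calJ f) = calJ (c • twistedTranslation k l f) := by
  refine ⟨(Complex.exp ((Real.pi * ⟪intVec k, intVec l⟫ : ℝ) * Complex.I))⁻¹, fun f => ?_⟩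
  rw [← calJIsometry_apply (_ • _), map_smul, calJIsometry_apply, calJ_twistedTranslation,
    smul_smul, inv_mul_cancel₀ (Complex.exp_ne_zero _), one_smul]
  rfl

/-- The range of `𝒥` is closed, contains the constants and is stable under multiplication by
characters, so its orthogonal complement is zero. -/
theorem calJ_surjective : Function.Surjective (calJ (n := n)) := by
  let W : Submodule ℂ (Lp (L2R n) 2 (torusMeasure2 n)) :=
    LinearMap.range (calJIsometry n).toLinearMap
  have hW : IsClosed (W : Set (Lp (L2R n) 2 (torusMeasure2 n))) :=
    (calJIsometry n).isometry.isClosedEmbedding.isClosed_range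
  have : CompleteSpace W := hW.completeSpace_coe
  have hbot : Wᗮ = ⊥ := by
    rw [Submodule.eq_bot_iff]
    intro F hF
    rw [Submodule.mem_orthogonal'] at hF
    refine Lp.ext ?_
    refine EventuallyEq.trans ?_ (Lp.coeFn_zero (L2R n) 2 (torusMeasure2 n)).symm
    refine ae_eq_zero_of_forall_inner (𝕜 := ℂ) fun a => ?_
    obtain ⟨f, hf⟩ := exists_calJ_eq_const a
    have h := ae_inner_eq_zero_of_forall_inner_charMul (F := F) (G := calJ f) fun k l => by
      obtain ⟨c, hc⟩ := exists_charMul_calJ (n := n) k l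
      rw [hc]
      exact hF _ ⟨_, rfl⟩
    filter_upwards [h, hf] with ω h1 h2
    rw [h2, inner_eq_zero_symm] at h1
    exact h1
  have htop : W = ⊤ := (Submodule.orthogonal_eq_bot_iff).1 hbot
  intro F
  have hF : F ∈ W := htop ▸ Submodule.mem_top
  exact hF

end Surjective

/-! ### Measurable fields of operators -/

section OperatorField

variable {Ω : Type*} [MeasurableSpace Ω] {μ : Measure Ω}
  {H : Type*} [NormedAddCommGroup H] [InnerProductSpace ℂ H] [CompleteSpace H]

theorem countable_of_orthonormal [TopologicalSpace.SeparableSpace H] {ι : Type*} {e : ι → H}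
    (he : Orthonormal ℂ e) : Countable ι := by
  -- the balls of radius `1/2` about the `e i` are disjoint
  refine Pairwise.countable_of_isOpen_disjoint (s := fun i => Metric.ball (e i) (1 / 2)) ?_
    (fun _ => Metric.isOpen_ball) (fun i => ⟨e i, Metric.mem_ball_self (by norm_num)⟩)
  intro i j hij
  refine Metric.ball_disjoint_ball ?_
  have h : ‖e i - e j‖ * ‖e i - e j‖ = 2 := by
    rw [norm_sub_mul_self (𝕜 := ℂ), he.1 i, he.1 j, he.2 hij]
    norm_num
  rw [dist_eq_norm]
  nlinarith [norm_nonneg (e i - e j)]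

/-- A weakly measurable function with values in a separable Hilbert space is measurable. -/
theorem aestronglyMeasurable_of_forall_inner [TopologicalSpace.SeparableSpace H] {f : Ω → H}
    (hf : ∀ b, AEMeasurable (fun ω => inner ℂ b (f ω)) μ) : AEStronglyMeasurable f μ := by
  obtain ⟨w, b, -⟩ := exists_hilbertBasis ℂ H
  have : Countable w := countable_of_orthonormal b.orthonormal
  refine aestronglyMeasurable_of_tendsto_ae (u := atTop)
    (f := fun (s : Finset w) ω => ∑ i ∈ s, inner ℂ (b i) (f ω) • b i) (fun s => ?_)
    (Eventually.of_forall fun ω => ?_)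
  · exact Finset.aestronglyMeasurable_fun_sum _ fun i _ =>
      (hf (b i)).aestronglyMeasurable.smul_const _
  · have h := b.hasSum_repr (f ω)
    simp_rw [b.repr_apply_apply] at h
    exact h

/-- The field is expanded along a countable Hilbert basis `b`: `S f = ∑ ⟨b i, f⟩ S (b i)`. -/
theorem aestronglyMeasurable_operator_apply [TopologicalSpace.SeparableSpace H]
    {S : Ω → H →L[ℂ] H} (hS : ∀ a b, AEMeasurable (fun ω => inner ℂ b (S ω a)) μ) {f : Ω → H}
    (hf : AEStronglyMeasurable f μ) : AEStronglyMeasurable (fun ω => S ω (f ω)) μ := by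
  obtain ⟨w, b, -⟩ := exists_hilbertBasis ℂ H
  have : Countable w := countable_of_orthonormal b.orthonormal
  refine aestronglyMeasurable_of_tendsto_ae (u := atTop)
    (f := fun (s : Finset w) ω => ∑ i ∈ s, inner ℂ (b i) (f ω) • S ω (b i)) (fun s => ?_)
    (Eventually.of_forall fun ω => ?_)
  · exact Finset.aestronglyMeasurable_fun_sum _ fun i _ =>
      (hf.const_inner).smul (aestronglyMeasurable_of_forall_inner (hS (b i)))
  · have h := (b.hasSum_repr (f ω)).mapL (S ω)
    simp_rw [b.repr_apply_apply, map_smul] at h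
    exact h

/-- A weakly measurable essentially bounded field of operators acts boundedly on `L²(μ; H)`. -/
theorem exists_lp_operator [TopologicalSpace.SeparableSpace H]
    {S : Ω → H →L[ℂ] H} (hS : ∀ a b, AEMeasurable (fun ω => inner ℂ b (S ω a)) μ) {C : ℝ}
    (hC : ∀ᵐ ω ∂μ, ‖S ω‖ ≤ C) :
    ∃ Φ : Lp H 2 μ →L[ℂ] Lp H 2 μ, ∀ F, ∀ᵐ ω ∂μ, Φ F ω = S ω (F ω) := by
  have hle : ∀ F : Lp H 2 μ, ∀ᵐ ω ∂μ, ‖S ω (F ω)‖ ≤ max C 0 * ‖F ω‖ := by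
    intro F
    filter_upwards [hC] with ω hω
    exact (S ω).le_of_opNorm_le (hω.trans (le_max_left _ _)) _
  have hmem : ∀ F : Lp H 2 μ, MemLp (fun ω => S ω (F ω)) 2 μ := fun F =>
    (Lp.memLp F).of_le_mul (aestronglyMeasurable_operator_apply hS (Lp.aestronglyMeasurable F))
      (hle F)
  let Φ : Lp H 2 μ →ₗ[ℂ] Lp H 2 μ :=
    { toFun := fun F => (hmem F).toLp _
      map_add' := fun F G => by
        rw [← MemLp.toLp_add, MemLp.toLp_eq_toLp_iff]
        filter_upwards [Lp.coeFn_add F G] with ω h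
        rw [h, Pi.add_apply, Pi.add_apply, map_add]
      map_smul' := fun c F => by
        rw [RingHom.id_apply, ← MemLp.toLp_const_smul, MemLp.toLp_eq_toLp_iff]
        filter_upwards [Lp.coeFn_smul c F] with ω h
        rw [h, Pi.smul_apply, Pi.smul_apply, map_smul] }
  refine ⟨Φ.mkContinuous (max C 0) fun F => ?_, fun F => (hmem F).coeFn_toLp⟩
  refine Lp.norm_le_mul_norm_of_ae_le_mul ?_
  filter_upwards [(hmem F).coeFn_toLp, hle F] with ω h1 h2
  exact (congrArg norm h1).trans_le h2

end OperatorField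

/-! ### Operators on a closed span -/

section ClosedSpan

variable {H : Type*} [NormedAddCommGroup H] [InnerProductSpace ℂ H] [CompleteSpace H] {ι : Type*}
  {K : ClosedSubmodule ℂ H} {u : ι → H}

theorem mem_of_eq_closure_span (hK : K = (Submodule.span ℂ (Set.range u)).closure) (i : ι) :
    u i ∈ K.toSubmodule := by
  rw [hK]
  exact subset_closure (Submodule.subset_span ⟨i, rfl⟩)

/-- Linear combinations of generators of `K`, as elements of `K`. -/
def spanMap (hK : K = (Submodule.span ℂ (Set.range u)).closure) : (ι →₀ ℂ) →ₗ[ℂ] K.toSubmodule :=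
  Finsupp.linearCombination ℂ fun i => ⟨u i, mem_of_eq_closure_span hK i⟩

theorem coe_spanMap (hK : K = (Submodule.span ℂ (Set.range u)).closure) (c : ι →₀ ℂ) :
    (spanMap hK c : H) = Finsupp.linearCombination ℂ u c := by
  simp [spanMap, Finsupp.linearCombination_apply, Finsupp.sum]

theorem denseRange_spanMap (hK : K = (Submodule.span ℂ (Set.range u)).closure) :
    DenseRange (spanMap hK) := by
  intro x
  rw [closure_subtype]
  have hx : (x : H) ∈ closure ((Submodule.span ℂ (Set.range u) : Submodule ℂ H) : Set H) :=
    hK.le x.2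
  refine closure_mono ?_ hx
  rintro y hy
  obtain ⟨c, rfl⟩ := (Finsupp.mem_span_range_iff_exists_finsupp).1 hy
  exact ⟨spanMap hK c, ⟨c, rfl⟩, by rw [coe_spanMap, Finsupp.linearCombination_apply]⟩

theorem operator_ext_of_eq_closure_span (hK : K = (Submodule.span ℂ (Set.range u)).closure)
    {R R' : K.toSubmodule →L[ℂ] H}
    (h : ∀ i, R ⟨u i, mem_of_eq_closure_span hK i⟩ = R' ⟨u i, mem_of_eq_closure_span hK i⟩) :
    R = R' := by
  have h1 : R.toLinearMap ∘ₗ spanMap hK = R'.toLinearMap ∘ₗ spanMap hK := by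
    refine Finsupp.lhom_ext' fun i => LinearMap.ext_ring ?_
    simpa [spanMap] using h i
  refine ContinuousLinearMap.ext fun x => ?_
  exact congrFun ((denseRange_spanMap hK).equalizer R.continuous R'.continuous
    (funext fun c => LinearMap.congr_fun h1 c)) x

/-- An assignment `u i ↦ v i` that is norm-bounded on linear combinations extends to a bounded
operator on the closed span of the `u i`. -/
theorem exists_operator_of_norm_le (hK : K = (Submodule.span ℂ (Set.range u)).closure) {v : ι → H}
    {C : ℝ} (hC : 0 ≤ C)
    (h : ∀ c : ι →₀ ℂ, ‖Finsupp.linearCombination ℂ v c‖ ≤ C * ‖Finsupp.linearCombination ℂ u c‖) :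
    ∃ R : K.toSubmodule →L[ℂ] H, ‖R‖ ≤ C ∧
      ∀ i, R ⟨u i, mem_of_eq_closure_span hK i⟩ = v i := by
  have h' : ∀ c, ‖Finsupp.linearCombination ℂ v c‖ ≤ C * ‖spanMap hK c‖ := fun c => by
    rw [Submodule.coe_norm, coe_spanMap]
    exact h c
  refine ⟨(Finsupp.linearCombination ℂ v).extendOfNorm (spanMap hK),
    LinearMap.opNorm_extendOfNorm_le (denseRange_spanMap hK) hC h', fun i => ?_⟩
  have h1 := LinearMap.extendOfNorm_eq (denseRange_spanMap hK) ⟨C, h'⟩ (Finsupp.single i 1)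
  simpa [spanMap] using h1

/-- For countable families it suffices to test a norm inequality between linear combinations on
countably many coefficient vectors. -/
theorem norm_linearCombination_le_of_denseSeq [Countable ι] {u v : ι → H} {C : ℝ}
    (h : ∀ (s : Finset ι) (j : ℕ),
      ‖∑ i ∈ s, TopologicalSpace.denseSeq (ι → ℂ) j i • v i‖ ≤
        C * ‖∑ i ∈ s, TopologicalSpace.denseSeq (ι → ℂ) j i • u i‖) (c : ι →₀ ℂ) :
    ‖Finsupp.linearCombination ℂ v c‖ ≤ C * ‖Finsupp.linearCombination ℂ u c‖ := by
  have key : ∀ d : ι → ℂ, ‖∑ i ∈ c.support, d i • v i‖ ≤ C * ‖∑ i ∈ c.support, d i • u i‖ := by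
    refine fun d => (TopologicalSpace.denseRange_denseSeq (ι → ℂ)).induction_on
      (p := fun d => ‖∑ i ∈ c.support, d i • v i‖ ≤ C * ‖∑ i ∈ c.support, d i • u i‖) d ?_ (h _)
    exact isClosed_le (by fun_prop) (by fun_prop)
  exact key c

end ClosedSpan

/-! ### Shift-invariant spaces are invariant under multiplication by indicators -/

section Indicator

variable {n : ℕ}

variable (n) in
/-- The unitary operator `𝒥`. -/
def calJEquiv : L2R2 n ≃ₗᵢ[ℂ] Lp (L2R n) 2 (torusMeasure2 n) :=
  LinearIsometryEquiv.ofSurjective (calJIsometry n) calJ_surjective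

theorem inner_calJ (f g : L2R2 n) : inner ℂ (calJ f) (calJ g) = inner ℂ f g :=
  (calJIsometry n).inner_map_map f g

theorem enorm_calJ (f : L2R2 n) : ‖calJ f‖ₑ = ‖f‖ₑ := by
  rw [← ofReal_norm, ← ofReal_norm, ← calJIsometry_apply, LinearIsometry.norm_map]

theorem coeFn_calJ_sub (f g : L2R2 n) :
    ∀ᵐ ω ∂(torusMeasure2 n), calJ (f - g) ω = calJ f ω - calJ g ω := by
  have h : calJ (f - g) = calJ f - calJ g := (calJIsometry n).map_sub f g
  rw [h]
  exact Lp.coeFn_sub _ _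

theorem coeFn_calJ_sum {ι : Type*} (s : Finset ι) (c : ι → ℂ) (f : ι → L2R2 n) :
    ∀ᵐ ω ∂(torusMeasure2 n), calJ (∑ i ∈ s, c i • f i) ω = ∑ i ∈ s, c i • calJ (f i) ω := by
  classical
  induction s using Finset.induction_on with
  | empty =>
    have h : calJ (0 : L2R2 n) = 0 := (calJIsometry n).map_zero
    simp only [Finset.sum_empty, h]
    exact Lp.coeFn_zero _ _ _
  | insert i s hi ih =>
    have h : calJ (c i • f i + ∑ i ∈ s, c i • f i) =
        c i • calJ (f i) + calJ (∑ i ∈ s, c i • f i) := by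
      simp only [← calJIsometry_apply, map_add, map_smul]
    simp only [Finset.sum_insert hi, h]
    filter_upwards [ih, Lp.coeFn_add (c i • calJ (f i)) (calJ (∑ i ∈ s, c i • f i)),
      Lp.coeFn_smul (c i) (calJ (f i))] with ω h1 h2 h3
    rw [h2, Pi.add_apply, h3, h1, Pi.smul_apply]

/-- Multiplication by the indicator of `s` on `L²(𝕋ⁿ × 𝕋ⁿ; L²(ℝⁿ))`. -/
def lpIndicator {s : Set (RSpace n × RSpace n)} (hs : MeasurableSet s)
    (F : Lp (L2R n) 2 (torusMeasure2 n)) : Lp (L2R n) 2 (torusMeasure2 n) :=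
  ((Lp.memLp F).indicator hs).toLp _

theorem inner_lpIndicator {s : Set (RSpace n × RSpace n)} (hs : MeasurableSet s)
    (F G : Lp (L2R n) 2 (torusMeasure2 n)) :
    inner ℂ G (lpIndicator hs F) = ∫ ω in s, inner ℂ (G ω) (F ω) ∂(torusMeasure2 n) := by
  rw [L2.inner_def, ← integral_indicator hs]
  refine integral_congr_ae ?_
  filter_upwards [((Lp.memLp F).indicator hs).coeFn_toLp] with ω h
  rw [lpIndicator, h]
  by_cases hω : ω ∈ s <;> simp [hω]

theorem enorm_lpIndicator_sq {s : Set (RSpace n × RSpace n)} (hs : MeasurableSet s)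
    (F : Lp (L2R n) 2 (torusMeasure2 n)) :
    ‖lpIndicator hs F‖ₑ ^ 2 = ∫⁻ ω in s, ‖F ω‖ₑ ^ 2 ∂(torusMeasure2 n) := by
  rw [Lp.enorm_def, eLpNorm_two_sq, ← lintegral_indicator hs]
  refine lintegral_congr_ae ?_
  filter_upwards [((Lp.memLp F).indicator hs).coeFn_toLp] with ω h
  rw [lpIndicator, h]
  by_cases hω : ω ∈ s <;> simp [hω]

variable {V : Submodule ℂ (L2R2 n)}

/-- If `h` is orthogonal to `V`, then `𝒥h` is orthogonal to `𝒥f` almost everywhere for `f ∈ V`. -/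
theorem ae_inner_calJ_eq_zero (hV : IsTwistedShiftInvariant V) {h f : L2R2 n} (hh : h ∈ Vᗮ)
    (hf : f ∈ V) : ∀ᵐ ω ∂(torusMeasure2 n), inner ℂ (calJ h ω) (calJ f ω) = 0 := by
  refine ae_inner_eq_zero_of_forall_inner_charMul fun k l => ?_
  obtain ⟨c, hc⟩ := exists_charMul_calJ (n := n) k l
  rw [hc, inner_calJ]
  exact (Submodule.mem_orthogonal' _ _).1 hh _ (V.smul_mem c (hV.translation_mem k l f hf))

/-- `𝒥V` is invariant under multiplication by indicators. -/
theorem exists_calJ_eq_lpIndicator (hV : IsTwistedShiftInvariant V) {f : L2R2 n} (hf : f ∈ V)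
    {s : Set (RSpace n × RSpace n)} (hs : MeasurableSet s) :
    ∃ g ∈ V, calJ g = lpIndicator hs (calJ f) := by
  have : CompleteSpace V := hV.isClosed.completeSpace_coe
  obtain ⟨g, hg⟩ := calJ_surjective (lpIndicator hs (calJ f))
  refine ⟨g, ?_, hg⟩
  rw [← V.orthogonal_orthogonal, Submodule.mem_orthogonal]
  intro h hh
  rw [← inner_calJ, hg, inner_lpIndicator]
  refine integral_eq_zero_of_ae (ae_restrict_of_ae ?_)
  exact ae_inner_calJ_eq_zero hV hh hf

/-- A twisted shift preserving operator commutes with multiplication by indicators. For every `h`,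
the functions `⟨𝒥h, 𝒥Uf⟩` and `⟨𝒥U*h, 𝒥f⟩` have the same Fourier coefficients, hence the same
integrals over all sets. -/
theorem calJ_apply_eq_lpIndicator (hV : IsTwistedShiftInvariant V) {U : V →L[ℂ] L2R2 n}
    (hU : IsTwistedShiftPreserving hV U) {f g : V} {s : Set (RSpace n × RSpace n)}
    (hs : MeasurableSet s) (hg : calJ (g : L2R2 n) = lpIndicator hs (calJ (f : L2R2 n))) :
    calJ (U g) = lpIndicator hs (calJ (U f)) := by
  have : CompleteSpace V := hV.isClosed.completeSpace_coe
  refine ext_inner_left ℂ fun G => ?_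
  obtain ⟨h, rfl⟩ := calJ_surjective G
  have hadj : ∀ x : V, inner ℂ h (U x) = inner ℂ (U.adjoint h : L2R2 n) (x : L2R2 n) := fun x =>
    (ContinuousLinearMap.adjoint_inner_left U x h).symm
  have key := ae_inner_eq_of_forall_inner_charMul (F := calJ h) (G := calJ (U f))
    (F' := calJ (U.adjoint h : L2R2 n)) (G' := calJ (f : L2R2 n)) fun k l => by
      obtain ⟨c, hc⟩ := exists_charMul_calJ (n := n) k l
      rw [hc, hc, inner_calJ, inner_calJ, inner_smul_right, inner_smul_right, ← hU k l f, hadj]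
  rw [inner_calJ, hadj, ← inner_calJ, hg, inner_lpIndicator, inner_lpIndicator]
  refine integral_congr_ae (ae_restrict_of_ae ?_)
  filter_upwards [key] with ω hω
  exact hω.symm

/-- The fibrewise bound for a twisted shift preserving operator. -/
theorem ae_norm_calJ_apply_le (hV : IsTwistedShiftInvariant V) {U : V →L[ℂ] L2R2 n}
    (hU : IsTwistedShiftPreserving hV U) (f : V) :
    ∀ᵐ ω ∂(torusMeasure2 n), ‖calJ (U f) ω‖ ≤ ‖U‖ * ‖calJ (f : L2R2 n) ω‖ := by
  have h1 : (fun ω => ‖calJ (U f) ω‖ₑ ^ 2) ≤ᵐ[torusMeasure2 n]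
      fun ω => ‖U‖ₑ ^ 2 * ‖calJ (f : L2R2 n) ω‖ₑ ^ 2 := by
    refine ae_le_of_forall_setLIntegral_le_of_sigmaFinite₀
      ((Lp.aestronglyMeasurable _).enorm.pow_const 2) fun s hs _ => ?_
    obtain ⟨g, hgV, hg⟩ := exists_calJ_eq_lpIndicator hV f.2 hs
    have h2 := calJ_apply_eq_lpIndicator hV hU (f := f) (g := ⟨g, hgV⟩) hs hg
    rw [lintegral_const_mul' _ _ (by simp), ← enorm_lpIndicator_sq hs, ← enorm_lpIndicator_sq hs,
      ← h2, ← hg, enorm_calJ, enorm_calJ, ← mul_pow]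
    gcongr
    exact U.le_opENorm ⟨g, hgV⟩
  filter_upwards [h1] with ω hω
  rw [← mul_pow, ENNReal.pow_le_pow_left_iff (by norm_num), ← ofReal_norm, ← ofReal_norm,
    ← ofReal_norm, ← ENNReal.ofReal_mul (norm_nonneg _)] at hω
  exact (ENNReal.ofReal_le_ofReal_iff (by positivity)).1 hω

end Indicator

/-! ### The range function -/

section RangeFunction

variable {n : ℕ} {V : Submodule ℂ (L2R2 n)}
  {J : RSpace n × RSpace n → ClosedSubmodule ℂ (L2R n)} {A : Set (L2R2 n)}

/-- Every `f ∈ V` is the limit of a sequence in `A` along which the fibres converge almost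
everywhere. -/
theorem exists_seq_tendsto_calJ {f : L2R2 n} (hf : f ∈ closure A) :
    ∃ a : ℕ → A, ∀ᵐ ω ∂(torusMeasure2 n),
      Tendsto (fun j => calJ (a j : L2R2 n) ω) atTop (𝓝 (calJ f ω)) := by
  obtain ⟨x, hxA, hx⟩ := mem_closure_iff_seq_limit.1 hf
  have h1 : Tendsto (fun j => calJ (x j)) atTop (𝓝 (calJ f)) :=
    ((calJIsometry n).continuous.tendsto f).comp hx
  obtain ⟨ns, -, hns⟩ := (tendstoInMeasure_of_tendsto_Lp h1).exists_seq_tendsto_ae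
  exact ⟨fun j => ⟨x (ns j), hxA _⟩, hns⟩

theorem ae_calJ_mem (hA : (V : Set (L2R2 n)) ⊆ closure A)
    (hJ : ∀ᵐ ω ∂(torusMeasure2 n),
      J ω = (Submodule.span ℂ (Set.range fun f : A => calJ (f : L2R2 n) ω)).closure)
    {f : L2R2 n} (hf : f ∈ V) :
    ∀ᵐ ω ∂(torusMeasure2 n), calJ f ω ∈ (J ω).toSubmodule := by
  obtain ⟨a, ha⟩ := exists_seq_tendsto_calJ (hA hf)
  filter_upwards [ha, hJ] with ω h1 h2
  exact (J ω).isClosed.mem_of_tendsto h1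
    (Eventually.of_forall fun j => mem_of_eq_closure_span h2 (a j))

/-- The orthogonal projections onto the fibres `J(ξ, ξ')` are implemented by the orthogonal
projection onto `V`. -/
theorem exists_calJ_eq_orthogonalProjectionOnto (hA : (V : Set (L2R2 n)) ⊆ closure A)
    (hJ : ∀ᵐ ω ∂(torusMeasure2 n),
      J ω = (Submodule.span ℂ (Set.range fun f : A => calJ (f : L2R2 n) ω)).closure)
    (hV : IsTwistedShiftInvariant V) (hAV : A ⊆ V)
    (hAc : A.Countable) (a : L2R n) :
    ∃ f : V, ∀ᵐ ω ∂(torusMeasure2 n),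
      calJ (f : L2R2 n) ω = (J ω).toSubmodule.orthogonalProjectionOnto a := by
  have : CompleteSpace V := hV.isClosed.completeSpace_coe
  have : Countable A := hAc.to_subtype
  obtain ⟨g, hg⟩ := exists_calJ_eq_const a
  refine ⟨V.orthogonalProjectionOnto g, ?_⟩
  have h1 : ∀ᵐ ω ∂(torusMeasure2 n), ∀ b : A,
      inner ℂ (calJ (g - V.starProjection g) ω) (calJ (b : L2R2 n) ω) = 0 :=
    ae_all_iff.2 fun b =>
      ae_inner_calJ_eq_zero hV (V.sub_starProjection_mem_orthogonal g) (hAV b.2)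
  filter_upwards [hg, h1, hJ, coeFn_calJ_sub g (V.starProjection g),
    ae_calJ_mem hA hJ (V.starProjection_apply_mem g)] with ω h1 h2 h3 h4 h5
  refine (Submodule.eq_starProjection_of_mem_orthogonal h5 ?_).symm
  rw [h3, ClosedSubmodule.orthogonal_closure, Submodule.mem_orthogonal']
  intro w hw
  rw [← h1, ← h4]
  induction hw using Submodule.span_induction with
  | mem x hx =>
    obtain ⟨b, rfl⟩ := hx
    exact h2 b
  | zero => exact inner_zero_right _
  | add x y _ _ hx hy => rw [inner_add_right, hx, hy, add_zero]
  | smul c x _ hx => rw [inner_smul_right, hx, mul_zero]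


/-- Outside one null set, the fibrewise bound holds for all linear combinations of elements of `A`
simultaneously. -/
theorem ae_norm_linearCombination_le (hV : IsTwistedShiftInvariant V) (hAV : A ⊆ V)
    (hAc : A.Countable) {U : V →L[ℂ] L2R2 n} (hU : IsTwistedShiftPreserving hV U) :
    ∀ᵐ ω ∂(torusMeasure2 n), ∀ c : A →₀ ℂ,
      ‖Finsupp.linearCombination ℂ (fun f : A => calJ (U ⟨f, hAV f.2⟩) ω) c‖ ≤
        ‖U‖ * ‖Finsupp.linearCombination ℂ (fun f : A => calJ (f : L2R2 n) ω) c‖ := by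
  have : Countable A := hAc.to_subtype
  have key : ∀ᵐ ω ∂(torusMeasure2 n), ∀ (s : Finset A) (j : ℕ),
      ‖∑ i ∈ s, TopologicalSpace.denseSeq (A → ℂ) j i • calJ (U ⟨i, hAV i.2⟩) ω‖ ≤
        ‖U‖ * ‖∑ i ∈ s, TopologicalSpace.denseSeq (A → ℂ) j i • calJ (i : L2R2 n) ω‖ := by
    refine ae_all_iff.2 fun s => ae_all_iff.2 fun j => ?_
    generalize TopologicalSpace.denseSeq (A → ℂ) j = c
    filter_upwards [ae_norm_calJ_apply_le hV hU (∑ i ∈ s, c i • ⟨i, hAV i.2⟩),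
      coeFn_calJ_sum s c fun i => U ⟨i, hAV i.2⟩, coeFn_calJ_sum s c fun i => (i : L2R2 n)]
      with ω h1 h2 h3
    have e1 : U (∑ i ∈ s, c i • ⟨i, hAV i.2⟩) = ∑ i ∈ s, c i • U ⟨i, hAV i.2⟩ := by
      rw [map_sum]
      exact Finset.sum_congr rfl fun i _ => U.map_smul _ _
    have e2 : ((∑ i ∈ s, c i • ⟨i, hAV i.2⟩ : V) : L2R2 n) = ∑ i ∈ s, c i • (i : L2R2 n) := by
      rw [Submodule.coe_sum]
      rfl
    rwa [e1, e2, h2, h3] at h1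
  filter_upwards [key] with ω hω
  exact norm_linearCombination_le_of_denseSeq hω

/-- If `𝒥Uf(ω) = R(ω) 𝒥f(ω)` holds for all `f ∈ A`, the fibrewise bound carries it over
to limits. -/
theorem corresponds_of_forall_mem (hA : (V : Set (L2R2 n)) ⊆ closure A)
    (hJ : ∀ᵐ ω ∂(torusMeasure2 n),
      J ω = (Submodule.span ℂ (Set.range fun f : A => calJ (f : L2R2 n) ω)).closure)
    (hV : IsTwistedShiftInvariant V) (hAV : A ⊆ V)
    {U : V →L[ℂ] L2R2 n} (hU : IsTwistedShiftPreserving hV U) {R : RangeOperator J}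
    (hR : ∀ᵐ ω ∂(torusMeasure2 n), ∀ (f : A) (h : calJ (f : L2R2 n) ω ∈ (J ω).toSubmodule),
      R ω ⟨calJ (f : L2R2 n) ω, h⟩ = calJ (U ⟨f, hAV f.2⟩) ω) :
    Corresponds U R := by
  intro f
  obtain ⟨a, ha⟩ := exists_seq_tendsto_calJ (hA f.2)
  have hb : ∀ᵐ ω ∂(torusMeasure2 n), ∀ j : ℕ,
      ‖calJ (U ⟨a j, hAV (a j).2⟩) ω - calJ (U f) ω‖ ≤
        ‖U‖ * ‖calJ (a j : L2R2 n) ω - calJ (f : L2R2 n) ω‖ := by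
    refine ae_all_iff.2 fun j => ?_
    filter_upwards [ae_norm_calJ_apply_le hV hU (⟨a j, hAV (a j).2⟩ - f),
      coeFn_calJ_sub (U ⟨a j, hAV (a j).2⟩) (U f), coeFn_calJ_sub (a j : L2R2 n) (f : L2R2 n)]
      with ω h1 h2 h3
    rw [← h2, ← h3]
    simpa using h1
  filter_upwards [ha, hb, hR, ae_calJ_mem hA hJ f.2, hJ] with ω h1 h2 h3 h4 h5
  refine ⟨h4, ?_⟩
  have hm : ∀ j, calJ (a j : L2R2 n) ω ∈ (J ω).toSubmodule := fun j =>
    mem_of_eq_closure_span h5 (a j)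
  have t1 : Tendsto (fun j => calJ (U ⟨a j, hAV (a j).2⟩) ω) atTop (𝓝 (calJ (U f) ω)) := by
    rw [tendsto_iff_norm_sub_tendsto_zero] at h1 ⊢
    have h6 := h1.const_mul ‖U‖
    rw [mul_zero] at h6
    exact squeeze_zero (fun _ => norm_nonneg _) h2 h6
  have t2 : Tendsto (fun j => R ω ⟨calJ (a j : L2R2 n) ω, hm j⟩) atTop
      (𝓝 (R ω ⟨calJ (f : L2R2 n) ω, h4⟩)) :=
    ((R ω).continuous.tendsto _).comp (tendsto_subtype_rng.2 h1)
  simp_rw [fun j => h3 (a j) (hm j)] at t2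
  exact tendsto_nhds_unique t1 t2

end RangeFunction

/-! ### The correspondence -/

section Correspondence

variable {n : ℕ} {V : Submodule ℂ (L2R2 n)}
  {J : RSpace n × RSpace n → ClosedSubmodule ℂ (L2R n)}

theorem IsRangeFunction.exists_generators (hJ : IsRangeFunction V J) :
    ∃ A : Set (L2R2 n), A.Countable ∧ A ⊆ V ∧ (V : Set (L2R2 n)) ⊆ closure A ∧
      ∀ᵐ ω ∂(torusMeasure2 n),
        J ω = (Submodule.span ℂ (Set.range fun f : A => calJ (f : L2R2 n) ω)).closure := by
  obtain ⟨A, hAc, hAV, hA, h⟩ := hJ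
  refine ⟨A, hAc, hAV, hA, ?_⟩
  simpa only [Set.image_eq_range] using h

/-- A range operator is determined by its values on the countably many generators of `J`. -/
theorem Corresponds.ae_eq {U : V →L[ℂ] L2R2 n} {R R' : RangeOperator J}
    (hJ : IsRangeFunction V J) (hR : Corresponds U R) (hR' : Corresponds U R') :
    ∀ᵐ ω ∂(torusMeasure2 n), R' ω = R ω := by
  obtain ⟨A, hAc, hAV, -, hJ⟩ := hJ.exists_generators
  have : Countable A := hAc.to_subtype
  have h : ∀ᵐ ω ∂(torusMeasure2 n), ∀ f : A, ∃ h : calJ (f : L2R2 n) ω ∈ (J ω).toSubmodule,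
      R' ω ⟨calJ (f : L2R2 n) ω, h⟩ = R ω ⟨calJ (f : L2R2 n) ω, h⟩ := by
    refine ae_all_iff.2 fun f => ?_
    filter_upwards [hR ⟨f, hAV f.2⟩, hR' ⟨f, hAV f.2⟩] with ω h1 h2
    obtain ⟨m1, e1⟩ := h1
    obtain ⟨m2, e2⟩ := h2
    exact ⟨m1, e2.symm.trans e1⟩
  filter_upwards [h, hJ] with ω h1 h2
  exact operator_ext_of_eq_closure_span h2 fun f => (h1 f).2

/-- Measurability is automatic: `P(ω)a = 𝒥f(ω)` for some `f ∈ V`, so that `R(ω)P(ω)a = 𝒥Uf(ω)`. -/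
theorem Corresponds.isMeasurable {U : V →L[ℂ] L2R2 n} {R : RangeOperator J}
    (hV : IsTwistedShiftInvariant V) (hJ : IsRangeFunction V J) (hR : Corresponds U R) :
    IsMeasurableRangeOperator R := by
  obtain ⟨A, hAc, hAV, hA, hJ⟩ := hJ.exists_generators
  intro a b
  obtain ⟨f, hf⟩ := exists_calJ_eq_orthogonalProjectionOnto hA hJ hV hAV hAc a
  have hm : AEStronglyMeasurable (fun ω => inner ℂ b (calJ (U f) ω)) (torusMeasure2 n) :=
    (Lp.aestronglyMeasurable (calJ (U f))).const_inner
  refine hm.aemeasurable.congr ?_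
  filter_upwards [hf, hR f] with ω h1 h2
  obtain ⟨m, e⟩ := h2
  rw [e]
  congr 2
  exact Subtype.ext h1

/-- Every twisted shift preserving operator is given by an essentially bounded range operator. -/
theorem exists_rangeOperator (hV : IsTwistedShiftInvariant V) (hJ : IsRangeFunction V J)
    {U : V →L[ℂ] L2R2 n} (hU : IsTwistedShiftPreserving hV U) :
    ∃ R : RangeOperator J, IsEssBounded R ∧ Corresponds U R := by
  obtain ⟨A, hAc, hAV, hA, hJ⟩ := hJ.exists_generators
  have hex : ∀ᵐ ω ∂(torusMeasure2 n), ∃ T : (J ω).toSubmodule →L[ℂ] L2R n, ‖T‖ ≤ ‖U‖ ∧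
      ∀ (f : A) (h : calJ (f : L2R2 n) ω ∈ (J ω).toSubmodule),
        T ⟨calJ (f : L2R2 n) ω, h⟩ = calJ (U ⟨f, hAV f.2⟩) ω := by
    filter_upwards [ae_norm_linearCombination_le hV hAV hAc hU, hJ] with ω h1 h2
    obtain ⟨T, hT, hTv⟩ := exists_operator_of_norm_le h2 (norm_nonneg U) h1
    exact ⟨T, hT, fun f _ => hTv f⟩
  -- on the exceptional null set the operator is irrelevant
  have hex' : ∀ ω, ∃ T : (J ω).toSubmodule →L[ℂ] L2R n,
      (∃ T : (J ω).toSubmodule →L[ℂ] L2R n, ‖T‖ ≤ ‖U‖ ∧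
        ∀ (f : A) (h : calJ (f : L2R2 n) ω ∈ (J ω).toSubmodule),
          T ⟨calJ (f : L2R2 n) ω, h⟩ = calJ (U ⟨f, hAV f.2⟩) ω) → ‖T‖ ≤ ‖U‖ ∧
        ∀ (f : A) (h : calJ (f : L2R2 n) ω ∈ (J ω).toSubmodule),
          T ⟨calJ (f : L2R2 n) ω, h⟩ = calJ (U ⟨f, hAV f.2⟩) ω := by
    intro ω
    by_cases h : ∃ T : (J ω).toSubmodule →L[ℂ] L2R n, ‖T‖ ≤ ‖U‖ ∧
        ∀ (f : A) (h : calJ (f : L2R2 n) ω ∈ (J ω).toSubmodule),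
          T ⟨calJ (f : L2R2 n) ω, h⟩ = calJ (U ⟨f, hAV f.2⟩) ω
    · obtain ⟨T, hT⟩ := h
      exact ⟨T, fun _ => hT⟩
    · exact ⟨0, fun h' => absurd h' h⟩
  choose R hR using hex'
  refine ⟨R, ⟨‖U‖, hex.mono fun ω hω => (hR ω hω).1⟩, ?_⟩
  exact corresponds_of_forall_mem hA hJ hV hAV hU (hex.mono fun ω hω => (hR ω hω).2)

/-- Every essentially bounded measurable range operator comes from a twisted shift preserving
operator. -/
theorem exists_twistedShiftPreserving (hV : IsTwistedShiftInvariant V) (hJ : IsRangeFunction V J)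
    {R : RangeOperator J} (hR : IsMeasurableRangeOperator R) (hb : IsEssBounded R) :
    ∃ U : V →L[ℂ] L2R2 n, IsTwistedShiftPreserving hV U ∧ Corresponds U R := by
  obtain ⟨A, hAc, hAV, hA, hJ⟩ := hJ.exists_generators
  obtain ⟨C, hC⟩ := hb
  let S : RSpace n × RSpace n → L2R n →L[ℂ] L2R n := fun ω =>
    R ω ∘L (J ω).toSubmodule.orthogonalProjectionOnto
  have hS : ∀ᵐ ω ∂(torusMeasure2 n), ‖S ω‖ ≤ C := by
    filter_upwards [hC] with ω hω
    refine ((R ω).opNorm_comp_le _).trans (le_trans ?_ hω)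
    exact mul_le_of_le_one_right (R ω).opNorm_nonneg (Submodule.orthogonalProjectionOnto_norm_le _)
  obtain ⟨Φ, hΦ⟩ := exists_lp_operator (S := S) hR hS
  let U : V →L[ℂ] L2R2 n :=
    (calJEquiv n).symm.toContinuousLinearEquiv.toContinuousLinearMap ∘L Φ ∘L
      (calJEquiv n).toContinuousLinearEquiv.toContinuousLinearMap ∘L V.subtypeL
  have hU : ∀ f : V, calJ (U f) = Φ (calJ (f : L2R2 n)) := fun f =>
    (calJEquiv n).apply_symm_apply _
  refine ⟨U, fun k l f => ?_, fun f => ?_⟩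
  · refine (calJIsometry n).injective ?_
    rw [calJIsometry_apply, calJIsometry_apply, hU, calJ_twistedTranslation,
      calJ_twistedTranslation, hU, map_smul]
    congr 1
    refine Lp.ext ?_
    filter_upwards [hΦ (phaseMul (charPhase k l) (measurable_charPhase k l) (calJ (f : L2R2 n))),
      coeFn_phaseMul (charPhase k l) (measurable_charPhase k l) (calJ (f : L2R2 n)),
      coeFn_phaseMul (charPhase k l) (measurable_charPhase k l) (Φ (calJ (f : L2R2 n))),
      hΦ (calJ (f : L2R2 n))] with ω h1 h2 h3 h4
    rw [h1, h2, h3, h4, map_smul]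
  · filter_upwards [hΦ (calJ (f : L2R2 n)), ae_calJ_mem hA hJ f.2] with ω h1 h2
    refine ⟨h2, ?_⟩
    rw [hU, h1]
    exact congrArg (R ω) (Submodule.orthogonalProjectionOnto_mem_subspace_eq_self ⟨_, h2⟩)

theorem Corresponds.operator_eq {U U' : V →L[ℂ] L2R2 n} {R : RangeOperator J}
    (hU : Corresponds U R) (hU' : Corresponds U' R) : U' = U := by
  refine ContinuousLinearMap.ext fun f => (calJIsometry n).injective (Lp.ext ?_)
  filter_upwards [hU f, hU' f] with ω h1 h2
  obtain ⟨m1, e1⟩ := h1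
  obtain ⟨m2, e2⟩ := h2
  exact e2.trans e1.symm

end Correspondence

end TwistedShift
end

theorem mainTheorem1 (n : ℕ)
    (V : Submodule ℂ (TwistedShift.L2R2 n)) (hV : TwistedShift.IsTwistedShiftInvariant V)
    (J : TwistedShift.RSpace n × TwistedShift.RSpace n →
      ClosedSubmodule ℂ (TwistedShift.L2R n))
    (hJ : TwistedShift.IsRangeFunction V J) :
    (∀ U : V →L[ℂ] TwistedShift.L2R2 n, TwistedShift.IsTwistedShiftPreserving hV U →
      ∃ R : TwistedShift.RangeOperator J,
        TwistedShift.IsMeasurableRangeOperator R ∧ TwistedShift.IsEssBounded R ∧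
        TwistedShift.Corresponds U R ∧
        ∀ R' : TwistedShift.RangeOperator J, TwistedShift.IsMeasurableRangeOperator R' →
          TwistedShift.Corresponds U R' →
          ∀ᵐ ω ∂(TwistedShift.torusMeasure2 n), R' ω = R ω) ∧
    (∀ R : TwistedShift.RangeOperator J, TwistedShift.IsMeasurableRangeOperator R →
      TwistedShift.IsEssBounded R →
      ∃! U : V →L[ℂ] TwistedShift.L2R2 n,
        TwistedShift.IsTwistedShiftPreserving hV U ∧ TwistedShift.Corresponds U R) := by
  refine ⟨fun U hU => ?_, fun R hR hb => ?_⟩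
  · obtain ⟨R, hb, hUR⟩ := TwistedShift.exists_rangeOperator hV hJ hU
    exact ⟨R, hUR.isMeasurable hV hJ, hb, hUR, fun R' _ hUR' => hUR.ae_eq hJ hUR'⟩
  · obtain ⟨U, hU, hUR⟩ := TwistedShift.exists_twistedShiftPreserving hV hJ hR hb
    exact ⟨U, ⟨hU, hUR⟩, fun U' hU' => hUR.operator_eq hU'.2⟩
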